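/- Let $g\ge 0$ and $\lambda_0,\dots,\lambda_{2g+1}\in\mathbb C$ (put $\lambda_k=0$ for $k\ge 2g+2$), and consider the curve $y^2=f(x)=\sum_{k=0}^{2g+1}\lambda_kx^k$. **The functions $\zeta_j$ and $\wp_{jk}$.** Let $\Omega\subseteq\mathbb C^g$ be a connected open set with coordinates $u_1,\dots,u_g$, and let $\zeta_1,\dots,\zeta_g$ be holomorphic on $\Omega$. Suppose that on some nonempty open $U\subseteq\Omega$ there are holomorphic functions $x_i,y_i$ ($1\le i\le g$) of $u$ solving Jacobi's inversion problem, that is, $y_i^2=f(x_i)$, $y_i\ne 0$, the $x_i$ are pairwise distinct at each point, and $$du_k=\sum_{i=1}^g\frac{x_i^{k-1}\,dx_i}{y_i}\qquad(1\le k\le g),$$ and that on $U$, for $1\le j\le g$, $$d(-\zeta_j)=\frac14\sum_{i=1}^g\frac{dx_i}{y_i}\sum_{k=j}^{2g+1-j}(k+1-j)\lambda_{k+1+j}x_i^k-\frac12\,d\Big(\sum_{i=1}^g\frac{y_i\,\chi_{g-j-1}(x_i;x_1,\dots,\check x_i,\dots,x_g)}{F'(x_i)}\Big).$$ Here $\check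 x_i$ means that $x_i$ is omitted, $F(x)=\prod_{r=1}^g(x-x_r)$, and $\chi_n(x;s)=\sum_{m=0}^n(-1)^mh_m(s)x^{n-m}$ with $h_m$ the $m$-th elementary symmetric function ($\chi_{-1}=0$). Put $\wp_{jk}=\partial(-\zeta_j)/\partial u_k$ and $\wp_{jklm}=\partial^2\wp_{jk}/\partial u_l\partial u_m$ for indices in $\{1,\dots,g\}$, and $\wp_{jk}=0$ if $j$ or $k$ is an integer outside $\{1,\dots,g\}$. **Notation.** Let $$[\mu\nu\rho\sigma]=\wp_{\mu\nu\rho\sigma}-2(\wp_{\mu\nu}\wp_{\rho\sigma}+\wp_{\mu\rho}\wp_{\nu\sigma}+\wp_{\mu\sigma}\wp_{\nu\rho}),$$ $$\langle\alpha\beta\rangle=\wp_{\alpha+1,\beta}-\wp_{\alpha,\beta+1},\qquad \langle\langle\alpha\beta\rangle\rangle=-(\wp_{\alpha-2,\beta+1}-3\wp_{\alpha-1,\beta}+3\wp_{\alpha,\beta-1}-\wp_{\alpha+1,\beta-2}),$$ $$\{\alpha,\alpha+1\}=-\{\alpha+1,\alpha\}=2\lambda_{2\alpha},\quad \{\alpha,\alpha+2\}=-\{\alpha+2,\alpha\}=\lambda_{2\alpha+1},\quad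 \{\alpha\beta\}=0\text{ otherwise},$$ $$\langle\alpha\beta\gamma\delta\rangle=\langle\alpha\beta\rangle\langle\gamma\delta\rangle-\langle\alpha\gamma\rangle\langle\beta\delta\rangle+\langle\alpha\delta\rangle\langle\beta\gamma\rangle,\qquad \{\alpha\beta\gamma\delta\}=\{\alpha\beta\}\{\gamma\delta\}-\{\alpha\gamma\}\{\beta\delta\}+\{\alpha\delta\}\{\beta\gamma\},$$ $$\langle\langle\alpha\beta\gamma\delta\rangle\rangle=\langle\langle\alpha\beta\rangle\rangle\{\gamma\delta\}-\langle\langle\alpha\gamma\rangle\rangle\{\beta\delta\}+\langle\langle\alpha\delta\rangle\rangle\{\beta\gamma\}+\{\alpha\beta\}\langle\langle\gamma\delta\rangle\rangle-\{\alpha\gamma\}\langle\langle\beta\delta\rangle\rangle+\{\alpha\delta\}\langle\langle\beta\gamma\rangle\rangle.$$ In the polynomial ring $\mathbb C[x,y,z,t]$ let $(\alpha\beta\gamma\delta)$ be the sum of the distinct monomials obtained from $x^\alpha y^\beta z^\gamma t^\delta$ by permuting the variables, $H=(2200)-(2110)+6(1111)$, and let $|\alpha\beta\gamma\delta|$ be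 the polynomial $D_{\alpha\beta\gamma\delta}/D_{3210}$, where $D_{\alpha\beta\gamma\delta}$ is the $4\times4$ determinant with rows $(x^e,y^e,z^e,t^e)$, $e=\alpha,\beta,\gamma,\delta$. **Theorem.** (i) At every point of $\Omega$, as an identity in $\mathbb C[x,y,z,t]$, $$\sum(\mu-1,\nu-1,\rho-1,\sigma-1)\,[\mu\nu\rho\sigma]=-2H\sum\langle\alpha\beta\gamma\delta\rangle\,|\alpha\beta\gamma\delta|+\frac12\sum\langle\langle\alpha\beta\gamma\delta\rangle\rangle\,|\alpha\beta\gamma\delta|-\frac18\sum\{\alpha\beta\gamma\delta\}\,|\alpha\beta\gamma\delta|,$$ where the sum on the left is over $g\ge\mu\ge\nu\ge\rho\ge\sigma\ge1$ and the sums on the right are over $g+2\ge\alpha>\beta>\gamma>\delta\ge0$. (ii) Consequently, for each of the quadruples $g\ge\mu\ge\nu\ge\rho\ge\sigma\ge1$, $[\mu\nu\rho\sigma]$ equals at every point of $\Omega$ the coefficient of $x^{\mu-1}y^{\nu-1}z^{\rho-1}t^{\sigma-1}$ in the right-hand side of (i); the number of these differential equations is $\binom{g+3}{4}$. -/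

import Mathlib

/-!
Coordinates `u_1, …, u_g` on `ℂ^g` are indexed by `Fin g` (so `u_j` is the coordinate with index
`j - 1`). The letters `℘` below take integer indices, with the usual convention that `℘_{jk}` is
zero as soon as an index lies outside `1, …, g`.
-/

namespace HyperWp

open MvPolynomial

noncomputable section

/-! ### The curve and Jacobi's inversion problem -/

/-- The coefficient `λ_k` of the curve `y² = ∑_{k=0}^{2g+1} λ_k x^k`, extended by zero to
`k ≥ 2g+2`. -/
def coef {g : ℕ} (lam : Fin (2 * g + 2) → ℂ) (k : ℕ) : ℂ :=
  if h : k < 2 * g + 2 then lam ⟨k, h⟩ else 0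

/-- `f(x) = ∑_{k=0}^{2g+1} λ_k x^k`. -/
def curveF {g : ℕ} (lam : Fin (2 * g + 2) → ℂ) (x : ℂ) : ℂ :=
  ∑ k : Fin (2 * g + 2), lam k * x ^ (k : ℕ)

/-- `(x_1, y_1), …, (x_g, y_g)`, as holomorphic functions of `u` in `U ⊆ ℂ^g`, solve Jacobi's
inversion problem: they are points of the curve, the `x_i` are pairwise distinct and the `y_i` are
nonzero, and `du_k = ∑_i x_i^{k-1} dx_i / y_i` for `k = 1, …, g`. -/
structure JacobiInversion {g : ℕ} (lam : Fin (2 * g + 2) → ℂ) (U : Set (Fin g → ℂ))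
    (x y : Fin g → (Fin g → ℂ) → ℂ) : Prop where
  analytic_x : ∀ i, AnalyticOnNhd ℂ (x i) U
  analytic_y : ∀ i, AnalyticOnNhd ℂ (y i) U
  on_curve : ∀ u ∈ U, ∀ i, y i u ^ 2 = curveF lam (x i u)
  y_ne_zero : ∀ u ∈ U, ∀ i, y i u ≠ 0
  x_distinct : ∀ u ∈ U, Function.Injective fun i => x i u
  du_eq : ∀ u ∈ U, ∀ k : Fin g,
    (ContinuousLinearMap.proj k : (Fin g → ℂ) →L[ℂ] ℂ) =
      ∑ i, (x i u ^ (k : ℕ) / y i u) • fderiv ℂ (x i) u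

/-! ### The functions `ζ_j` -/

/-- `χ_n(X; s) = ∑_{m=0}^{n} (-1)^m h_m(s) X^{n-m}`, with `h_m(s)` the `m`-th elementary symmetric
function of the family `s`; it is `0` for `n = -1`. -/
def chi (n : ℤ) (X : ℂ) (s : Multiset ℂ) : ℂ :=
  ∑ m ∈ Finset.range (n + 1).toNat, (-1) ^ m * s.esymm m * X ^ (n - m).toNat

/-- `F'(x_i) = ∏_{r ≠ i} (x_i - x_r)`, where `F(X) = ∏_r (X - x_r)`. -/
def derivF {g : ℕ} (a : Fin g → ℂ) (i : Fin g) : ℂ :=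
  ∏ r ∈ Finset.univ.erase i, (a i - a r)

/-- `∑_i y_i χ_{g-j-1}(x_i; x_1, …, x_g without x_i) / F'(x_i)`, with `j = (j : Fin g) + 1`. -/
def chiSum {g : ℕ} (j : Fin g) (a b : Fin g → ℂ) : ℂ :=
  ∑ i, b i * chi ((g : ℤ) - ((j : ℕ) + 1) - 1) (a i) ((Finset.univ.erase i).val.map a) / derivF a i

/-- The differential form
`d(-ζ_j) = ¼ ∑_i (dx_i / y_i) ∑_{k=j}^{2g+1-j} (k+1-j) λ_{k+1+j} x_i^k
            - ½ d(∑_i y_i χ_{g-j-1}(x_i; x_1, …, x_g without x_i) / F'(x_i))`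
at `u`; the index `j : Fin g` stands for `j + 1`. -/
def zetaForm {g : ℕ} (lam : Fin (2 * g + 2) → ℂ) (x y : Fin g → (Fin g → ℂ) → ℂ) (j : Fin g)
    (u : Fin g → ℂ) : (Fin g → ℂ) →L[ℂ] ℂ :=
  (1 / 4 : ℂ) • ∑ i, ((∑ k ∈ Finset.Icc ((j : ℕ) + 1) (2 * g + 1 - ((j : ℕ) + 1)),
      ((k : ℂ) + 1 - (((j : ℕ) : ℂ) + 1)) * coef lam (k + 1 + ((j : ℕ) + 1)) * x i u ^ k) / y i u) •
        fderiv ℂ (x i) u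
    - (1 / 2 : ℂ) • fderiv ℂ (fun v => chiSum j (fun i => x i v) (fun i => y i v)) u

/-- `ζ_1, …, ζ_g` are the hyperelliptic zeta functions of the curve on the connected open set `Ω`:
they are holomorphic on `Ω` and, on some nonempty open part `U` of `Ω` where Jacobi's inversion
problem is solved by `(x_i, y_i)`, the differentials `d(-ζ_j)` are the forms `zetaForm`. -/
structure IsZeta {g : ℕ} (lam : Fin (2 * g + 2) → ℂ) (Ω : Set (Fin g → ℂ))
    (ζ : Fin g → (Fin g → ℂ) → ℂ) : Prop where
  isOpen : IsOpen Ω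
  isPreconnected : IsPreconnected Ω
  analytic : ∀ j, AnalyticOnNhd ℂ (ζ j) Ω
  differential : ∃ (U : Set (Fin g → ℂ)) (x y : Fin g → (Fin g → ℂ) → ℂ),
    U ⊆ Ω ∧ IsOpen U ∧ U.Nonempty ∧ JacobiInversion lam U x y ∧
      ∀ u ∈ U, ∀ j, fderiv ℂ (fun v => -ζ j v) u = zetaForm lam x y j u

/-! ### The functions `℘` -/

/-- The partial derivative `∂φ/∂u_k` for `1 ≤ k ≤ g` (and `0` for any other integer `k`). -/
def pderivU {g : ℕ} (k : ℤ) (φ : (Fin g → ℂ) → ℂ) (u : Fin g → ℂ) : ℂ :=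
  if h : 1 ≤ k ∧ k ≤ g then fderiv ℂ φ u (Pi.single ⟨(k - 1).toNat, by omega⟩ 1) else 0

/-- `℘_{jk} = ∂(-ζ_j)/∂u_k` for `1 ≤ j, k ≤ g`, and `0` for other integer indices. -/
def wp {g : ℕ} (ζ : Fin g → (Fin g → ℂ) → ℂ) (j k : ℤ) (u : Fin g → ℂ) : ℂ :=
  if h : 1 ≤ j ∧ j ≤ g then pderivU k (fun v => -ζ ⟨(j - 1).toNat, by omega⟩ v) u else 0

/-- `℘_{jklm} = ∂²℘_{jk}/∂u_l∂u_m`. -/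
def wp4 {g : ℕ} (ζ : Fin g → (Fin g → ℂ) → ℂ) (j k l m : ℤ) (u : Fin g → ℂ) : ℂ :=
  pderivU m (pderivU l (wp ζ j k)) u

/-! ### The bracket symbols -/

/-- `[μνρσ] = ℘_{μνρσ} - 2 (℘_{μν} ℘_{ρσ} + ℘_{μρ} ℘_{νσ} + ℘_{μσ} ℘_{νρ})`. -/
def sqBr {g : ℕ} (ζ : Fin g → (Fin g → ℂ) → ℂ) (m : Fin 4 → ℕ) (u : Fin g → ℂ) : ℂ :=
  wp4 ζ (m 0) (m 1) (m 2) (m 3) u -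
    2 * (wp ζ (m 0) (m 1) u * wp ζ (m 2) (m 3) u + wp ζ (m 0) (m 2) u * wp ζ (m 1) (m 3) u +
      wp ζ (m 0) (m 3) u * wp ζ (m 1) (m 2) u)

/-- `⟨αβ⟩ = ℘_{α+1,β} - ℘_{α,β+1}`. -/
def ang2 {g : ℕ} (ζ : Fin g → (Fin g → ℂ) → ℂ) (u : Fin g → ℂ) (α β : ℕ) : ℂ :=
  wp ζ (α + 1) β u - wp ζ α (β + 1) u

/-- `⟨⟨αβ⟩⟩ = -(℘_{α-2,β+1} - 3 ℘_{α-1,β} + 3 ℘_{α,β-1} - ℘_{α+1,β-2})`. -/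
def dang2 {g : ℕ} (ζ : Fin g → (Fin g → ℂ) → ℂ) (u : Fin g → ℂ) (α β : ℕ) : ℂ :=
  -(wp ζ ((α : ℤ) - 2) ((β : ℤ) + 1) u - 3 * wp ζ ((α : ℤ) - 1) β u
    + 3 * wp ζ α ((β : ℤ) - 1) u - wp ζ ((α : ℤ) + 1) ((β : ℤ) - 2) u)

/-- `{α,α+1} = -{α+1,α} = 2 λ_{2α}`, `{α,α+2} = -{α+2,α} = λ_{2α+1}`, and `{αβ} = 0` otherwise. -/
def cur2 {g : ℕ} (lam : Fin (2 * g + 2) → ℂ) (α β : ℕ) : ℂ :=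
  if β = α + 1 then 2 * coef lam (2 * α)
  else if α = β + 1 then -(2 * coef lam (2 * β))
  else if β = α + 2 then coef lam (2 * α + 1)
  else if α = β + 2 then -coef lam (2 * β + 1)
  else 0

/-- `⟨αβγδ⟩ = ⟨αβ⟩⟨γδ⟩ - ⟨αγ⟩⟨βδ⟩ + ⟨αδ⟩⟨βγ⟩`. -/
def ang4 {g : ℕ} (ζ : Fin g → (Fin g → ℂ) → ℂ) (u : Fin g → ℂ) (a : Fin 4 → ℕ) : ℂ :=
  ang2 ζ u (a 0) (a 1) * ang2 ζ u (a 2) (a 3) - ang2 ζ u (a 0) (a 2) * ang2 ζ u (a 1) (a 3)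
    + ang2 ζ u (a 0) (a 3) * ang2 ζ u (a 1) (a 2)

/-- `{αβγδ} = {αβ}{γδ} - {αγ}{βδ} + {αδ}{βγ}`. -/
def cur4 {g : ℕ} (lam : Fin (2 * g + 2) → ℂ) (a : Fin 4 → ℕ) : ℂ :=
  cur2 lam (a 0) (a 1) * cur2 lam (a 2) (a 3) - cur2 lam (a 0) (a 2) * cur2 lam (a 1) (a 3)
    + cur2 lam (a 0) (a 3) * cur2 lam (a 1) (a 2)

/-- `⟨⟨αβγδ⟩⟩ = ⟨⟨αβ⟩⟩{γδ} - ⟨⟨αγ⟩⟩{βδ} + ⟨⟨αδ⟩⟩{βγ} + {αβ}⟨⟨γδ⟩⟩ - {αγ}⟨⟨βδ⟩⟩ + {αδ}⟨⟨βγ⟩⟩`. -/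
def dang4 {g : ℕ} (lam : Fin (2 * g + 2) → ℂ) (ζ : Fin g → (Fin g → ℂ) → ℂ) (u : Fin g → ℂ)
    (a : Fin 4 → ℕ) : ℂ :=
  dang2 ζ u (a 0) (a 1) * cur2 lam (a 2) (a 3) - dang2 ζ u (a 0) (a 2) * cur2 lam (a 1) (a 3)
    + dang2 ζ u (a 0) (a 3) * cur2 lam (a 1) (a 2)
    + cur2 lam (a 0) (a 1) * dang2 ζ u (a 2) (a 3) - cur2 lam (a 0) (a 2) * dang2 ζ u (a 1) (a 3)
    + cur2 lam (a 0) (a 3) * dang2 ζ u (a 1) (a 2)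

/-! ### Symmetric polynomials in four variables `x, y, z, t` -/

/-- `(αβγδ)`: the sum of the distinct monomials obtained from `x^α y^β z^γ t^δ` by permuting the
variables, e.g. `(1100) = xy + yz + zx + xt + yt + zt`. -/
def symMon (a : Fin 4 → ℕ) : MvPolynomial (Fin 4) ℂ :=
  ∑ b ∈ Finset.univ.image (fun π : Equiv.Perm (Fin 4) => a ∘ π), ∏ i, X i ^ b i

/-- `H = (2200) - (2110) + 6 (1111)`. -/
def polyH : MvPolynomial (Fin 4) ℂ :=
  symMon ![2, 2, 0, 0] - symMon ![2, 1, 1, 0] + 6 * symMon ![1, 1, 1, 1]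

/-- The determinant with rows `(x^α, y^α, z^α, t^α)`, …, `(x^δ, y^δ, z^δ, t^δ)`. -/
def altDet (a : Fin 4 → ℕ) : MvPolynomial (Fin 4) ℂ :=
  (Matrix.of fun r c : Fin 4 => (X c : MvPolynomial (Fin 4) ℂ) ^ a r).det

/-- `M`, the determinant with exponents `3, 2, 1, 0`. -/
def polyM : MvPolynomial (Fin 4) ℂ := altDet ![3, 2, 1, 0]

theorem polyM_eq : polyM = (X 0 - X 1) * ((X 0 - X 2) * ((X 0 - X 3) *
    ((X 1 - X 2) * ((X 1 - X 3) * (X 2 - X 3))))) := by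
  simp [polyM, altDet, Matrix.det_succ_row_zero, Fin.sum_univ_succ, Fin.succAbove]
  ring

theorem sub_dvd_altDet (a : Fin 4 → ℕ) {i j : Fin 4} (h : i ≠ j) :
    (X i - X j : MvPolynomial (Fin 4) ℂ) ∣ altDet a := by
  rw [← Ideal.mem_span_singleton, ← Ideal.Quotient.eq_zero_iff_mem, altDet, RingHom.map_det]
  refine Matrix.det_zero_of_column_eq h fun r => ?_
  have : Ideal.Quotient.mk (Ideal.span {(X i - X j : MvPolynomial (Fin 4) ℂ)}) (X i) =
      Ideal.Quotient.mk _ (X j) := by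
    rw [Ideal.Quotient.eq, Ideal.mem_span_singleton]
  simp [this]

theorem irreducible_sub {i j : Fin 4} (h : i ≠ j) :
    Irreducible (X i - X j : MvPolynomial (Fin 4) ℂ) := by
  have e : (X i - X j : MvPolynomial (Fin 4) ℂ) =
      sumSMulX (Finsupp.single i 1 - Finsupp.single j 1) := by
    simp [sumSMulX]
  have hi : (Finsupp.single i 1 - Finsupp.single j 1 : Fin 4 →₀ ℂ) i = 1 := by
    simp [Finsupp.single_eq_of_ne h]
  rw [e]
  refine irreducible_sumSMulX _ ⟨i, ?_⟩ fun r hr => ?_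
  · rw [Finsupp.mem_support_iff, hi]
    exact one_ne_zero
  · have := hr i
    rw [hi] at this
    exact isUnit_of_dvd_one this

theorem isRelPrime_sub {i j k l : Fin 4} (h : i ≠ j) (v : Fin 4 → ℂ) (h1 : v i = v j)
    (h2 : v k ≠ v l) : IsRelPrime (X i - X j : MvPolynomial (Fin 4) ℂ) (X k - X l) := by
  rw [(irreducible_sub h).isRelPrime_iff_not_dvd]
  rintro ⟨q, hq⟩
  have := congrArg (MvPolynomial.eval v) hq
  simp [h1, sub_eq_zero, h2] at this

/-- `M` divides every determinant `altDet a`. -/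
theorem polyM_dvd_altDet (a : Fin 4 → ℕ) : polyM ∣ altDet a := by
  rw [polyM_eq]
  refine IsRelPrime.mul_dvd ?_ (sub_dvd_altDet a (by decide)) ?_
  · refine IsRelPrime.mul_right ?_ (IsRelPrime.mul_right ?_
      (IsRelPrime.mul_right ?_ (IsRelPrime.mul_right ?_ ?_)))
    all_goals refine isRelPrime_sub (by decide) ![0, 0, 1, 2] ?_ ?_ <;> simp
  refine IsRelPrime.mul_dvd ?_ (sub_dvd_altDet a (by decide)) ?_
  · refine IsRelPrime.mul_right ?_ (IsRelPrime.mul_right ?_ (IsRelPrime.mul_right ?_ ?_))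
    all_goals refine isRelPrime_sub (by decide) ![0, 1, 0, 2] ?_ ?_ <;> simp
  refine IsRelPrime.mul_dvd ?_ (sub_dvd_altDet a (by decide)) ?_
  · refine IsRelPrime.mul_right ?_ (IsRelPrime.mul_right ?_ ?_)
    all_goals refine isRelPrime_sub (by decide) ![0, 1, 2, 0] ?_ ?_ <;> simp
  refine IsRelPrime.mul_dvd ?_ (sub_dvd_altDet a (by decide)) ?_
  · refine IsRelPrime.mul_right ?_ ?_
    all_goals refine isRelPrime_sub (by decide) ![0, 1, 1, 2] ?_ ?_ <;> simp
  refine IsRelPrime.mul_dvd ?_ (sub_dvd_altDet a (by decide)) (sub_dvd_altDet a (by decide))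
  refine isRelPrime_sub (by decide) ![0, 1, 2, 1] ?_ ?_ <;> simp

/-- `|αβγδ| = altDet (α, β, γ, δ) / M`, the exact quotient of polynomials. -/
def quotDet (a : Fin 4 → ℕ) : MvPolynomial (Fin 4) ℂ := (polyM_dvd_altDet a).choose

theorem polyM_mul_quotDet (a : Fin 4 → ℕ) : polyM * quotDet a = altDet a :=
  (polyM_dvd_altDet a).choose_spec.symm

/-! ### Index sets -/

/-- The quadruples `g ≥ μ ≥ ν ≥ ρ ≥ σ ≥ 1`. -/
def weakQuads (g : ℕ) : Finset (Fin 4 → ℕ) :=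
  (Fintype.piFinset fun _ => Finset.Icc 1 g).filter fun m => m 1 ≤ m 0 ∧ m 2 ≤ m 1 ∧ m 3 ≤ m 2

/-- The quadruples `g + 2 ≥ α > β > γ > δ ≥ 0`. -/
def strictQuads (g : ℕ) : Finset (Fin 4 → ℕ) :=
  (Fintype.piFinset fun _ => Finset.range (g + 3)).filter
    fun a => a 1 < a 0 ∧ a 2 < a 1 ∧ a 3 < a 2

end

end HyperWp

/-! Let F = ∏(X - x_i), let V be the polynomial of degree less than g with V(x_i) = y_i, and let W =
(f - V²)/F. Put T(z) = (F(z), V(z), W(z)). For the polarization `bil` of β² + αγ, T(z) paired with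
itself gives 2f(z). All the ℘_{jk} are collected in G(z, w) = ∑ ℘_{jk} z^{j-1} w^{k-1} (`gen`), and
the derivative along (1, w, …, w^{g-1}) (`dir`) is the generating polynomial of the partial
derivatives ∂/∂u_k.

Jacobi's equations say that along `dir g w` each x_i moves with velocity y_i ℓ_i(w), where ℓ_i is
the Lagrange basis polynomial. It follows that T(z) moves by the cross product, with respect to
`bil`, of T(w) and T(z), divided by w - z, plus an infinitesimal rotation that does not depend on z
(`flow`, `hasDerivAt_triple`).

The formula that carries the proof is 4(z - w)² G(z, w) = `polar`(z, w) - `bil`(T(z), T(w))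
(`sum_zetaForm`, `gen_eq`), where `polar` is the polarized curve. Since `polar` does not depend on
u, one further derivative of G is a determinant of three T's (`fderiv_gen`), and another one is a
combination of products of two values of `bil` (`fderiv_fderiv_gen`). Expressing these values
through G and `polar` gives, by the rational identity `quartic_identity`, the required system
multiplied by the Vandermonde determinant M, at generic arguments.

It remains to read off coefficients. The symbols ⟨αβ⟩, ⟨⟨αβ⟩⟩, {αβ} have generating functions (y -
x)G, -(x - y)³G and (y - x)·`polar`. The four-index symbols are Pfaffians, so they alternate under
permutations of the indices, and their generating functions are combinations of the determinants
D_{αβγδ} (`sum_pf_altDet`); division by M gives |αβγδ|. On the left the symmetry of [μνρσ] is used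
in the same way. The identity on U extends to Ω by analytic continuation, and (ii) is a comparison
of coefficients. -/

namespace HyperWp

/-! ### Algebra of the quadratic form β² + αγ and of the flow. -/

/-- The determinant of three vectors. -/
def det3 {K : Type*} [Field K] (p q r : K × K × K) : K :=
  p.1 * (q.2.1 * r.2.2 - r.2.1 * q.2.2) - p.2.1 * (q.1 * r.2.2 - r.1 * q.2.2)
    + p.2.2 * (q.1 * r.2.1 - r.1 * q.2.1)

/-- The polarization of the quadratic form `β² + αγ` in `(α, β, γ)`. -/
def bil {K : Type*} [Field K] (p q : K × K × K) : K :=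
  2 * p.2.1 * q.2.1 + p.1 * q.2.2 + p.2.2 * q.1

/-- The derivative at the parameter `z` of the triple `p`, along the direction with
parameter `w` and triple `q`; `l` is the leading coefficient of the curve. -/
def flow {K : Type*} [Field K] (l w z : K) (p q : K × K × K) : K × K × K :=
  ((q.1 * p.2.1 - q.2.1 * p.1) / (w - z),
   (p.1 * q.2.2 - q.1 * p.2.2) / (w - z) / 2 + l * p.1 * q.1 / 2,
   (p.2.2 * q.2.1 - p.2.1 * q.2.2) / (w - z) - l * p.1 * q.2.1)

/-- The first triple passed to `flow` belongs to the direction, the second is the one that moves.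
The terms with `l` form an infinitesimal rotation of `bil`, the same at every parameter, and cancel.
The cross product terms each contribute the same determinant up to sign, with the different weights
1/(t - x) and 1/(t - y). -/
theorem bil_flow {K : Type*} [Field K] [CharZero K] (x y t l : K) (p q r : K × K × K)
    (h1 : t - x ≠ 0) (h2 : t - y ≠ 0) :
    bil (flow l t x r p) q + bil p (flow l t y r q) =
      -det3 p q r * (x - y) / ((t - x) * (t - y)) := by
  simp only [bil, flow, det3]
  field_simp
  ring

/-- The `l` terms act by one trace-free matrix and so leave the determinant fixed. A determinant
with a cross product as one entry expands into products of values of `bil`. -/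
theorem det3_flow {K : Type*} [Field K] [CharZero K] (x y t l z : K) (p q r s : K × K × K)
    (h1 : z - x ≠ 0) (h2 : z - y ≠ 0) (h3 : z - t ≠ 0) :
    det3 (flow l z x s p) q r + det3 p (flow l z y s q) r + det3 p q (flow l z t s r) =
      ((bil s q * bil p r - bil s r * bil p q) / (z - x)
        + (bil s r * bil q p - bil s p * bil q r) / (z - y)
        + (bil s p * bil r q - bil s q * bil r p) / (z - t)) / 2 := by
  simp only [bil, flow, det3]
  field_simp
  ring

/-- The rational identity that turns the second derivatives of the polar form of `℘` into
Pfaffians of `℘` and of the polarized curve. -/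
theorem quartic_identity {K : Type*} [Field K] [CharZero K] (x y z t : K)
    (Q01 Q02 Q03 Q12 Q13 Q23 F01 F02 F03 F12 F13 F23 H p01 p02 p03 p12 p13 p23 : K)
    (h1 : x - y ≠ 0) (h2 : x - z ≠ 0) (h3 : x - t ≠ 0)
    (h4 : y - z ≠ 0) (h5 : y - t ≠ 0) (h6 : z - t ≠ 0)
    (hH : H = (x ^ 2 * y ^ 2 + x ^ 2 * z ^ 2 + x ^ 2 * t ^ 2 + y ^ 2 * z ^ 2 + y ^ 2 * t ^ 2
        + z ^ 2 * t ^ 2)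
      - (x ^ 2 * y * z + x ^ 2 * y * t + x ^ 2 * z * t + y ^ 2 * x * z + y ^ 2 * x * t
        + y ^ 2 * z * t + z ^ 2 * x * y + z ^ 2 * x * t + z ^ 2 * y * t + t ^ 2 * x * y
        + t ^ 2 * x * z + t ^ 2 * y * z)
      + 6 * (x * y * z * t))
    (e01 : p01 = (F01 - Q01) / (4 * (x - y) ^ 2))
    (e02 : p02 = (F02 - Q02) / (4 * (x - z) ^ 2))
    (e03 : p03 = (F03 - Q03) / (4 * (x - t) ^ 2))
    (e12 : p12 = (F12 - Q12) / (4 * (y - z) ^ 2))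
    (e13 : p13 = (F13 - Q13) / (4 * (y - t) ^ 2))
    (e23 : p23 = (F23 - Q23) / (4 * (z - t) ^ 2)) :
    (x - y) * (x - z) * (x - t) * (y - z) * (y - t) * (z - t) *
      (((Q13 * Q02 - Q23 * Q01) / (t - x) + (Q23 * Q01 - Q03 * Q12) / (t - y)
          + (Q03 * Q12 - Q13 * Q02) / (t - z)) / 2 / (4 * (x - y) * (z - x) * (z - y))
        - 2 * (p01 * p23 + p02 * p13 + p03 * p12)) =
      -2 * H * ((x - y) * (z - t) * p01 * p23 - (x - z) * (y - t) * p02 * p13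
        + (x - t) * (y - z) * p03 * p12)
      + 1 / 2 * ((x - y) ^ 3 * (z - t) * p01 * F23 - (x - z) ^ 3 * (y - t) * p02 * F13
        + (x - t) ^ 3 * (y - z) * p03 * F12 + (x - y) * (z - t) ^ 3 * p23 * F01
        - (x - z) * (y - t) ^ 3 * p13 * F02 + (x - t) * (y - z) ^ 3 * p12 * F03)
      - 1 / 8 * ((x - y) * (z - t) * F01 * F23 - (x - z) * (y - t) * F02 * F13
        + (x - t) * (y - z) * F03 * F12) := by
  -- Eliminating the values F_{ij} of the polarized curve leaves the p's and Q's as free variables,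
  -- with denominators only in the first group of terms.
  have f01 : F01 = 4 * (x - y) ^ 2 * p01 + Q01 := by rw [e01]; field_simp; ring
  have f02 : F02 = 4 * (x - z) ^ 2 * p02 + Q02 := by rw [e02]; field_simp; ring
  have f03 : F03 = 4 * (x - t) ^ 2 * p03 + Q03 := by rw [e03]; field_simp; ring
  have f12 : F12 = 4 * (y - z) ^ 2 * p12 + Q12 := by rw [e12]; field_simp; ring
  have f13 : F13 = 4 * (y - t) ^ 2 * p13 + Q13 := by rw [e13]; field_simp; ring
  have f23 : F23 = 4 * (z - t) ^ 2 * p23 + Q23 := by rw [e23]; field_simp; ring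
  rw [f01, f02, f03, f12, f13, f23, hH]
  have g1 : z - x ≠ 0 := by rw [← neg_sub]; exact neg_ne_zero.mpr h2
  have g2 : z - y ≠ 0 := by rw [← neg_sub]; exact neg_ne_zero.mpr h4
  have g5 : t - z ≠ 0 := by rw [← neg_sub]; exact neg_ne_zero.mpr h6
  have g3 : t - x ≠ 0 := by rw [← neg_sub]; exact neg_ne_zero.mpr h3
  have g4 : t - y ≠ 0 := by rw [← neg_sub]; exact neg_ne_zero.mpr h5
  -- The Vandermonde factor absorbs all the denominators, so that a polynomial identity remains.
  have key : ∀ A B C : K, (x - y) * (x - z) * (x - t) * (y - z) * (y - t) * (z - t) *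
      ((A / (t - x) + B / (t - y) + C / (t - z)) / 2 / (4 * (x - y) * (z - x) * (z - y))) =
      (-(A * (y - t) * (z - t)) - B * (x - t) * (z - t) - C * (x - t) * (y - t)) / 8 := by
    intro A B C
    field_simp
    ring
  rw [mul_sub, key]
  ring

end HyperWp

/-! ### The polynomials F, V, W and their variation. -/

namespace HyperWp
open Polynomial

noncomputable section

/-- The polynomial `f`. -/
def curvePoly {g : ℕ} (lam : Fin (2 * g + 2) → ℂ) : ℂ[X] :=
  ∑ k : Fin (2 * g + 2), C (lam k) * X ^ (k : ℕ)

theorem eval_curvePoly {g : ℕ} (lam : Fin (2 * g + 2) → ℂ) (z : ℂ) :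
    (curvePoly lam).eval z = curveF lam z := by
  simp [curvePoly, curveF, eval_finsetSum]

theorem coeff_curvePoly {g : ℕ} (lam : Fin (2 * g + 2) → ℂ) (n : ℕ) :
    (curvePoly lam).coeff n = coef lam n := by
  simp only [curvePoly, finsetSum_coeff, coeff_C_mul, coeff_X_pow, coef]
  split_ifs with h
  · rw [Finset.sum_eq_single ⟨n, h⟩]
    · simp
    · intro b _ hb
      rw [if_neg, mul_zero]
      rintro rfl
      exact hb rfl
    · simp
  · refine Finset.sum_eq_zero fun b _ => ?_
    rw [if_neg, mul_zero]
    rintro rfl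
    exact h b.2

theorem natDegree_curvePoly_le {g : ℕ} (lam : Fin (2 * g + 2) → ℂ) :
    (curvePoly lam).natDegree ≤ 2 * g + 1 := by
  rw [natDegree_le_iff_coeff_eq_zero]
  intro N hN
  rw [coeff_curvePoly, coef, dif_neg (by omega)]

/-- `F(X) = ∏_i (X - a_i)`. -/
abbrev nodalPoly {g : ℕ} (a : Fin g → ℂ) : ℂ[X] := Lagrange.nodal Finset.univ a

/-- The polynomial of degree less than `g` with values `b_i` at `a_i`. -/
abbrev interpPoly {g : ℕ} (a b : Fin g → ℂ) : ℂ[X] := Lagrange.interpolate Finset.univ a b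

abbrev basisPoly {g : ℕ} (a : Fin g → ℂ) (i : Fin g) : ℂ[X] := Lagrange.basis Finset.univ a i

/-- The quotient `(f - V²) / F`, where `V` interpolates the values `b_i` at `a_i`. -/
def coPoly {g : ℕ} (lam : Fin (2 * g + 2) → ℂ) (a b : Fin g → ℂ) : ℂ[X] :=
  (curvePoly lam - interpPoly a b ^ 2) /ₘ nodalPoly a

section

variable {g : ℕ} {lam : Fin (2 * g + 2) → ℂ} {a b : Fin g → ℂ}

theorem coeff_interpPoly (ha : Function.Injective a) {n : ℕ} (hn : g ≤ n) :
    (interpPoly a b).coeff n = 0 := by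
  have := Lagrange.degree_interpolate_lt (s := Finset.univ) (v := a) b ha.injOn
  refine coeff_eq_zero_of_degree_lt (this.trans_le ?_)
  simpa using hn

theorem natDegree_interpPoly_sq_le (ha : Function.Injective a) :
    (interpPoly a b ^ 2).natDegree ≤ 2 * g := by
  refine natDegree_pow_le_of_le 2 ?_
  rw [natDegree_le_iff_coeff_eq_zero]
  intro N hN
  exact coeff_interpPoly ha hN.le

theorem natDegree_nodalPoly : (nodalPoly a).natDegree = g := by
  simp [Lagrange.natDegree_nodal]

theorem eval_interpPoly_node (ha : Function.Injective a) (i : Fin g) :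
    (interpPoly a b).eval (a i) = b i :=
  Lagrange.eval_interpolate_at_node b ha.injOn (Finset.mem_univ i)

/-- Vanishing at the nodes means divisibility by the nodal polynomial. -/
theorem nodalPoly_dvd (ha : Function.Injective a) {p : ℂ[X]} (h : ∀ i, p.eval (a i) = 0) :
    nodalPoly a ∣ p := by
  rw [← modByMonic_eq_zero_iff_dvd (Lagrange.nodal_monic (s := Finset.univ) (v := a))]
  refine eq_zero_of_degree_lt_of_eval_index_eq_zero (s := Finset.univ) (v := a) ha.injOn ?_
    fun i hi => ?_
  · exact (degree_modByMonic_lt _ Lagrange.nodal_monic).trans_eq Lagrange.degree_nodal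
  · have := congrArg (eval (a i)) (modByMonic_add_div p (nodalPoly a))
    simpa [h i, Lagrange.eval_nodal_at_node hi] using this

theorem nodalPoly_mul_coPoly (ha : Function.Injective a)
    (hab : ∀ i, b i ^ 2 = curveF lam (a i)) :
    nodalPoly a * coPoly lam a b = curvePoly lam - interpPoly a b ^ 2 := by
  have hd : nodalPoly a ∣ curvePoly lam - interpPoly a b ^ 2 := by
    refine nodalPoly_dvd ha fun i => ?_
    rw [eval_sub, eval_pow, eval_interpPoly_node ha, eval_curvePoly, hab, sub_self]
  have := modByMonic_add_div (curvePoly lam - interpPoly a b ^ 2) (nodalPoly a)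
  rwa [(modByMonic_eq_zero_iff_dvd Lagrange.nodal_monic).2 hd, zero_add] at this

theorem natDegree_coPoly_le (ha : Function.Injective a) :
    (coPoly lam a b).natDegree ≤ g + 1 := by
  rw [coPoly, natDegree_divByMonic _ Lagrange.nodal_monic, natDegree_nodalPoly]
  have h1 := natDegree_sub_le (curvePoly lam) (interpPoly a b ^ 2)
  have h2 := natDegree_curvePoly_le lam
  have h3 := natDegree_interpPoly_sq_le (b := b) ha
  have : max (curvePoly lam).natDegree (interpPoly a b ^ 2).natDegree ≤ 2 * g + 1 :=
    max_le h2 (h3.trans (by omega))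
  omega

theorem coeff_coPoly (ha : Function.Injective a)
    (hab : ∀ i, b i ^ 2 = curveF lam (a i)) :
    (coPoly lam a b).coeff (g + 1) = coef lam (2 * g + 1) := by
  have h := congrArg (coeff · (g + (g + 1))) (nodalPoly_mul_coPoly ha hab)
  rw [coeff_mul_add_eq_of_natDegree_le natDegree_nodalPoly.le (natDegree_coPoly_le ha), coeff_sub,
    coeff_eq_zero_of_natDegree_lt (n := g + (g + 1))
      ((natDegree_interpPoly_sq_le (b := b) ha).trans_lt (by omega)), coeff_curvePoly] at h
  have h1 : (nodalPoly a).coeff g = 1 := by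
    have := (Lagrange.nodal_monic (s := Finset.univ) (v := a)).coeff_natDegree
    rwa [natDegree_nodalPoly] at this
  rw [h1, one_mul, sub_zero] at h
  rw [h]; congr 1; omega

/-- The variation of the nodal polynomial along `δa_i = b_i ℓ_i(w)`. -/
theorem nodalPoly_flow {w z : ℂ} (hw : ∀ i, w ≠ a i) (hz : ∀ i, z ≠ a i) :
    (w - z) * ∑ i, (b i * (basisPoly a i).eval w) * ∏ r ∈ Finset.univ.erase i, (z - a r) =
      (interpPoly a b).eval z * (nodalPoly a).eval w
        - (nodalPoly a).eval z * (interpPoly a b).eval w := by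
  rw [Lagrange.eval_interpolate_not_at_node _ fun i _ => hz i,
    Lagrange.eval_interpolate_not_at_node _ fun i _ => hw i]
  simp only [Finset.mul_sum, Finset.sum_mul, ← Finset.sum_sub_distrib]
  refine Finset.sum_congr rfl fun i hi => ?_
  rw [Lagrange.eval_basis_not_at_node hi (hw i)]
  have h1 : (nodalPoly a).eval z = (z - a i) * ∏ r ∈ Finset.univ.erase i, (z - a r) := by
    rw [Lagrange.eval_nodal, Finset.mul_prod_erase _ (fun r => z - a r) hi]
  have h2 := sub_ne_zero.2 (hw i)
  have h3 := sub_ne_zero.2 (hz i)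
  rw [h1]
  field_simp
  ring

/-- The variation of the interpolating polynomial along `δa_i = b_i ℓ_i(w)`,
`2 b_i δb_i = f'(a_i) δa_i`. -/
theorem interpPoly_flow (ha : Function.Injective a) (hab : ∀ i, b i ^ 2 = curveF lam (a i))
    (hb : ∀ i, b i ≠ 0) {q : ℂ[X]} (hq : ∀ n, g ≤ n → q.coeff n = 0) {w : ℂ}
    (hw : ∀ i, w ≠ a i) {da db : Fin g → ℂ} (hda : ∀ i, da i = b i * (basisPoly a i).eval w)
    (hdb : ∀ i, 2 * b i * db i = (derivative (curvePoly lam)).eval (a i) * da i)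
    (hqa : ∀ i, q.eval (a i) + (derivative (interpPoly a b)).eval (a i) * da i = db i) (z : ℂ) :
    (w - z) * q.eval z =
      ((nodalPoly a).eval w * (coPoly lam a b).eval z
        - (nodalPoly a).eval z * (coPoly lam a b).eval w) / 2
      + coef lam (2 * g + 1) / 2 * (w - z) * (nodalPoly a).eval w * (nodalPoly a).eval z := by
  -- The difference of the two sides as a polynomial in z. Its degree is at most g, and it vanishes
  -- at w and at the g nodes, which are g + 1 distinct points.
  set p : ℂ[X] := (C w - X) * q
    - C (1 / 2) * (C ((nodalPoly a).eval w) * coPoly lam a b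
        - nodalPoly a * C ((coPoly lam a b).eval w))
    - C (coef lam (2 * g + 1) / 2 * (nodalPoly a).eval w) * ((C w - X) * nodalPoly a) with hp
  have hN : ∀ n, g < n → (nodalPoly a).coeff n = 0 := fun n hn =>
    coeff_eq_zero_of_natDegree_lt (by rwa [natDegree_nodalPoly])
  have h1 : (nodalPoly a).coeff g = 1 := by
    have := (Lagrange.nodal_monic (s := Finset.univ) (v := a)).coeff_natDegree
    rwa [natDegree_nodalPoly] at this
  -- Differentiate FW = f - V² and evaluate at a node, where F vanishes.
  have hder : ∀ i, (derivative (curvePoly lam)).eval (a i) =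
      2 * b i * (derivative (interpPoly a b)).eval (a i)
        + (derivative (nodalPoly a)).eval (a i) * (coPoly lam a b).eval (a i) := by
    intro i
    have h := congrArg (fun r => (derivative r).eval (a i)) (nodalPoly_mul_coPoly ha hab)
    simp only [derivative_mul, derivative_sub, derivative_pow, eval_add, eval_mul, eval_sub,
      Lagrange.eval_nodal_at_node (Finset.mem_univ i), eval_interpPoly_node ha, eval_pow] at h
    norm_num [-Lagrange.interpolate_apply, eval_interpPoly_node ha] at h
    linear_combination -h
  have hp0 : p = 0 := by
    refine eq_zero_of_degree_lt_of_eval_finset_eq_zero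
      (insert w (Finset.univ.image a)) ?_ ?_
    · rw [Finset.card_insert_of_notMem (by simpa using fun i => (hw i).symm),
        Finset.card_image_of_injective _ ha, Finset.card_univ, Fintype.card_fin,
        degree_lt_iff_coeff_zero]
      rintro (_ | n) hn
      · omega
      have hn' : g ≤ n := by omega
      simp only [hp, coeff_sub, coeff_C_mul, sub_mul, coeff_X_mul, coeff_mul_C, hq _ hn',
        hq (n + 1) (by omega), hN (n + 1) (by omega)]
      -- Only the coefficient of X^{g+1} is not termwise zero: the leading coefficient of W is
      -- λ_{2g+1}, and the correction term with `coef lam (2 * g + 1)` is there to cancel it.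
      rcases hn'.eq_or_lt with rfl | hlt
      · rw [coeff_coPoly ha hab, h1]; ring
      · rw [coeff_eq_zero_of_natDegree_lt ((natDegree_coPoly_le ha).trans_lt (by omega)), hN n hlt]
        ring
    · intro c hc
      rw [Finset.mem_insert, Finset.mem_image] at hc
      rcases hc with rfl | ⟨i, hi, rfl⟩
      · simp [hp]
      · have h2 := hqa i
        have h3 := hdb i
        have hwi := sub_ne_zero.2 (hw i)
        have hb' := hb i
        have hbas : (basisPoly a i).eval w * ((w - a i) *
            (derivative (nodalPoly a)).eval (a i)) = (nodalPoly a).eval w := by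
          rw [Lagrange.eval_basis_not_at_node hi (hw i),
            Lagrange.nodalWeight_eq_eval_derivative_nodal hi]
          have : (derivative (nodalPoly a)).eval (a i) ≠ 0 := by
            intro h0
            have := Lagrange.nodalWeight_ne_zero (s := Finset.univ) (v := a) ha.injOn hi
            rw [Lagrange.nodalWeight_eq_eval_derivative_nodal hi, h0] at this
            simp at this
          field_simp
        rw [hder i] at h3
        have h4 : q.eval (a i) * 2 =
            (derivative (nodalPoly a)).eval (a i) * (coPoly lam a b).eval (a i)
              * (basisPoly a i).eval w := by
          have : b i * (q.eval (a i) * 2) = b i * ((derivative (nodalPoly a)).eval (a i)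
              * (coPoly lam a b).eval (a i) * (basisPoly a i).eval w) := by
            rw [hda i] at h2 h3
            linear_combination h3 + 2 * b i * h2
          exact mul_left_cancel₀ hb' this
        simp only [hp, eval_sub, eval_mul, eval_C, eval_X, Lagrange.eval_nodal_at_node hi]
        rw [← hbas]
        linear_combination (w - a i) / 2 * h4
  have := congrArg (eval z) hp0
  simp only [hp, eval_sub, eval_mul, eval_C, eval_X, eval_zero] at this
  linear_combination this

theorem eval_interpPoly (c : Fin g → ℂ) (w : ℂ) :
    (interpPoly a c).eval w = ∑ i, c i * (basisPoly a i).eval w := by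
  simp [Lagrange.interpolate_apply, eval_finsetSum]

theorem pow_eq_sum_basisPoly (ha : Function.Injective a) (w : ℂ) (k : Fin g) :
    w ^ (k : ℕ) = ∑ i, a i ^ (k : ℕ) * (basisPoly a i).eval w := by
  rw [← eval_interpPoly]
  have := Lagrange.eq_interpolate (s := Finset.univ) (v := a) (f := (X : ℂ[X]) ^ (k : ℕ)) ha.injOn
    (by rw [degree_X_pow]; simp)
  have h := congrArg (eval w) this
  simpa using h

end

end

end HyperWp

/-! ### The polarized curve, integrands of the second kind, and the generating function of the χ
sums. -/

namespace HyperWp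
open Polynomial

noncomputable section

/-- `F(z, x) = ∑_i (zx)^i (2 c_{2i} + c_{2i+1} (z + x))` with `g + 1` summands. -/
def polar (g : ℕ) (c : ℕ → ℂ) (z x : ℂ) : ℂ :=
  ∑ i ∈ Finset.range (g + 1), (z * x) ^ i * (2 * c (2 * i) + c (2 * i + 1) * (z + x))

/-- The integrands of the second kind, collected into one polynomial in `z` and `x`. -/
def secondKind (g : ℕ) (c : ℕ → ℂ) (z x : ℂ) : ℂ :=
  ∑ j ∈ Finset.range g, z ^ j * ∑ k ∈ Finset.Icc (j + 1) (2 * g + 1 - (j + 1)),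
    ((k : ℂ) + 1 - ((j : ℂ) + 1)) * c (k + 1 + (j + 1)) * x ^ k

theorem polar_succ (g : ℕ) (c : ℕ → ℂ) (z x : ℂ) :
    polar (g + 1) c z x = 2 * c 0 + c 1 * (z + x) + z * x * polar g (fun n => c (n + 2)) z x := by
  rw [polar, Finset.sum_range_succ', polar, Finset.mul_sum, add_comm]
  congr 1
  · simp
  · refine Finset.sum_congr rfl fun i _ => ?_
    rw [show 2 * (i + 1) = 2 * i + 2 by ring, show 2 * i + 2 + 1 = 2 * i + 1 + 2 by ring]
    ring

theorem secondKind_succ (g : ℕ) (c : ℕ → ℂ) (hc : c (2 * g + 4) = 0) (z x : ℂ) :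
    secondKind (g + 1) c z x = ∑ n ∈ Finset.range (2 * g + 2), (n : ℂ) * c (n + 2) * x ^ n
      + z * x * secondKind g (fun n => c (n + 2)) z x := by
  rw [secondKind, Finset.sum_range_succ', add_comm]
  congr 1
  · rw [pow_zero, one_mul, show 2 * (g + 1) + 1 - (0 + 1) = 2 * g + 2 by omega, zero_add,
      show Finset.Icc 1 (2 * g + 2) = Finset.Ico 1 (2 * g + 3) from rfl,
      Finset.sum_Ico_eq_sub _ (by omega), Finset.sum_range_succ, hc]
    simp
  · rw [secondKind, Finset.mul_sum]
    refine Finset.sum_congr rfl fun j hj => ?_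
    rw [Finset.mem_range] at hj
    rw [show 2 * (g + 1) + 1 - (j + 1 + 1) = (2 * g + 1 - (j + 1)) + 1 by omega,
      show Finset.Icc (j + 1 + 1) (2 * g + 1 - (j + 1) + 1) =
        Finset.Ico (j + 1 + 1) (2 * g + 1 - (j + 1) + 1 + 1) from rfl, ← Finset.sum_Ico_add',
      show Finset.Icc (j + 1) (2 * g + 1 - (j + 1)) =
        Finset.Ico (j + 1) (2 * g + 1 - (j + 1) + 1) from rfl, Finset.mul_sum, Finset.mul_sum,
      Finset.mul_sum]
    refine Finset.sum_congr rfl fun k _ => ?_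
    rw [show k + 1 + 1 + (j + 1 + 1) = k + 1 + (j + 1) + 2 by ring]
    push_cast
    ring

/-- As a function of z, the polarized curve has value 2f(x) and derivative f'(x) at z = x; the
second kind integrand is its second order Taylor remainder divided by (z - x)². The induction splits
off c_0 + c_1 x and divides the rest of f by x², which lowers g by one. -/
theorem secondKind_eq (g : ℕ) (c : ℕ → ℂ) (hc : ∀ n, 2 * g + 2 ≤ n → c n = 0) (z x : ℂ) :
    (z - x) ^ 2 * secondKind g c z x = polar g c z x
      - 2 * ∑ n ∈ Finset.range (2 * g + 2), c n * x ^ n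
      - (z - x) * ∑ n ∈ Finset.range (2 * g + 2), (n : ℂ) * c n * x ^ (n - 1) := by
  induction g generalizing c with
  | zero => simp [secondKind, polar, Finset.sum_range_succ]; ring
  | succ g ih =>
    rw [secondKind_succ g c (hc _ (by omega)), polar_succ,
      show 2 * (g + 1) + 2 = 2 * g + 2 + 1 + 1 by ring, Finset.sum_range_succ' (fun n => c n * x ^ n),
      Finset.sum_range_succ' (fun n => c (n + 1) * x ^ (n + 1)),
      Finset.sum_range_succ' (fun n => (n : ℂ) * c n * x ^ (n - 1)),
      Finset.sum_range_succ' (fun n => ((n + 1 : ℕ) : ℂ) * c (n + 1) * x ^ (n + 1 - 1))]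
    have h := ih (fun n => c (n + 2)) fun n hn => hc _ (by omega)
    have e1 : ∑ n ∈ Finset.range (2 * g + 2), c (n + 1 + 1) * x ^ (n + 1 + 1) =
        x ^ 2 * ∑ n ∈ Finset.range (2 * g + 2), c (n + 2) * x ^ n := by
      rw [Finset.mul_sum]
      exact Finset.sum_congr rfl fun n _ => by ring
    have e2 : ∑ n ∈ Finset.range (2 * g + 2), ((n + 1 + 1 : ℕ) : ℂ) * c (n + 1 + 1)
          * x ^ (n + 1 + 1 - 1) =
        x * ∑ n ∈ Finset.range (2 * g + 2), (n : ℂ) * c (n + 2) * x ^ n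
          + 2 * x * ∑ n ∈ Finset.range (2 * g + 2), c (n + 2) * x ^ n := by
      rw [Finset.mul_sum, Finset.mul_sum, ← Finset.sum_add_distrib]
      refine Finset.sum_congr rfl fun n _ => ?_
      rw [Nat.add_sub_cancel]
      push_cast
      ring
    have e3 : ∑ n ∈ Finset.range (2 * g + 2), (n : ℂ) * c (n + 2) * x ^ n =
        x * ∑ n ∈ Finset.range (2 * g + 2), (n : ℂ) * c (n + 2) * x ^ (n - 1) := by
      rw [Finset.mul_sum]
      refine Finset.sum_congr rfl fun n _ => ?_
      rcases n with _ | n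
      · simp
      · rw [Nat.add_sub_cancel]; ring
    rw [e1, e2, e3]
    simp only [zero_add, pow_zero, pow_one, Nat.cast_zero, Nat.cast_one]
    linear_combination z * x * h

section

variable {g : ℕ} {lam : Fin (2 * g + 2) → ℂ} {a b : Fin g → ℂ}

theorem coef_eq_zero {n : ℕ} (hn : 2 * g + 2 ≤ n) : coef lam n = 0 :=
  dif_neg (by omega)

theorem curveF_eq_sum_range (x : ℂ) :
    curveF lam x = ∑ n ∈ Finset.range (2 * g + 2), coef lam n * x ^ n := by
  rw [curveF, Finset.sum_range]
  exact Finset.sum_congr rfl fun k _ => by simp [coef]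

theorem eval_derivative_curvePoly (x : ℂ) :
    (derivative (curvePoly lam)).eval x =
      ∑ n ∈ Finset.range (2 * g + 2), (n : ℂ) * coef lam n * x ^ (n - 1) := by
  rw [Finset.sum_range, curvePoly]
  simp only [derivative_sum, eval_finsetSum]
  refine Finset.sum_congr rfl fun k _ => ?_
  simp [coef, derivative_X_pow]
  ring

theorem secondKind_coef (z x : ℂ) :
    (z - x) ^ 2 * secondKind g (coef lam) z x = polar g (coef lam) z x
      - 2 * curveF lam x - (z - x) * (derivative (curvePoly lam)).eval x := by
  rw [secondKind_eq g _ (fun n => coef_eq_zero), ← curveF_eq_sum_range, eval_derivative_curvePoly]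

/-- `F(z, ·)` as a polynomial. -/
def polarPoly (g : ℕ) (c : ℕ → ℂ) (z : ℂ) : ℂ[X] :=
  ∑ i ∈ Finset.range (g + 1),
    (C z * X) ^ i * (C (2 * c (2 * i)) + C (c (2 * i + 1)) * (C z + X))

theorem eval_polarPoly (c : ℕ → ℂ) (z x : ℂ) : (polarPoly g c z).eval x = polar g c z x := by
  simp [polarPoly, polar, eval_finsetSum]

theorem natDegree_polarPoly_le (c : ℕ → ℂ) (z : ℂ) : (polarPoly g c z).natDegree ≤ g + 1 := by
  refine natDegree_sum_le_of_forall_le _ _ fun i hi => ?_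
  rw [Finset.mem_range] at hi
  refine (natDegree_mul_le_of_le (m := i) (n := 1) ?_ ?_).trans (by omega)
  · exact (natDegree_pow_le_of_le i (p := C z * X) (m := 1) (by compute_degree)).trans_eq
      (mul_one i)
  · compute_degree

theorem polar_self (z : ℂ) : polar g (coef lam) z z = 2 * curveF lam z := by
  have := secondKind_coef (lam := lam) z z
  simp only [sub_self] at this
  linear_combination -this

/-- By the Taylor formula, now read as an identity of polynomials in the second argument, the
derivative at z is 2f'(z) - f'(z). -/
theorem eval_derivative_polarPoly (z : ℂ) :
    (derivative (polarPoly g (coef lam) z)).eval z = (derivative (curvePoly lam)).eval z := by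
  set S : ℂ[X] := ∑ j ∈ Finset.range g, C (z ^ j) *
    ∑ k ∈ Finset.Icc (j + 1) (2 * g + 1 - (j + 1)),
      C (((k : ℂ) + 1 - ((j : ℂ) + 1)) * coef lam (k + 1 + (j + 1))) * X ^ k with hS
  have hSe : ∀ x, S.eval x = secondKind g (coef lam) z x := fun x => by
    simp [hS, secondKind, eval_finsetSum]
  have h : polarPoly g (coef lam) z = (C z - X) ^ 2 * S + 2 * curvePoly lam
      + (C z - X) * derivative (curvePoly lam) := by
    refine Polynomial.funext fun x => ?_
    have := secondKind_coef (lam := lam) z x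
    simp only [eval_add, eval_mul, eval_pow, eval_sub, eval_C, eval_X, eval_ofNat, hSe,
      eval_polarPoly, eval_curvePoly]
    linear_combination -this
  rw [h]
  simp [derivative_pow]
  ring

/-- Interpolation of `G(X) / (z - X)²`. -/
theorem eval_interpPoly_div_sq (ha : Function.Injective a) {G : ℂ[X]} (hG : G.natDegree ≤ g + 1)
    {z : ℂ} (hz : ∀ i, z ≠ a i) (w : ℂ) :
    (z - w) ^ 2 * (interpPoly a fun i => G.eval (a i) / (z - a i) ^ 2).eval w =
      G.eval w - (nodalPoly a).eval w / (nodalPoly a).eval z * (G.eval z + (w - z) *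
        ((derivative G).eval z
          - (derivative (nodalPoly a)).eval z * G.eval z / (nodalPoly a).eval z)) := by
  set P := interpPoly a fun i => G.eval (a i) / (z - a i) ^ 2 with hP
  have hNz : (nodalPoly a).eval z ≠ 0 := Lagrange.eval_nodal_not_at_node fun i _ => hz i
  -- At the nodes (z - X)²P agrees with G, so the difference is F·L. Counting degrees makes L
  -- linear, and the value and the derivative at X = z, where (z - X)²P vanishes doubly, determine
  -- L.
  obtain ⟨L, hL⟩ : nodalPoly a ∣ (C z - X) ^ 2 * P - G := by
    refine nodalPoly_dvd ha fun i => ?_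
    have := sub_ne_zero.2 (hz i)
    rw [eval_sub, eval_mul, hP, eval_interpPoly_node ha]
    simp only [eval_pow, eval_sub, eval_C, eval_X]
    field_simp
    ring
  have hLdeg : L.natDegree ≤ 1 := by
    rw [natDegree_le_iff_coeff_eq_zero]
    intro N hN
    by_contra hne
    have h1 : 2 ≤ L.natDegree := hN.trans_le (le_natDegree_of_ne_zero hne)
    have h2 : (nodalPoly a * L).natDegree = g + L.natDegree := by
      rw [Lagrange.nodal_monic.natDegree_mul' (by rintro rfl; simp at hne), natDegree_nodalPoly]
    have h3 : ((C z - X) ^ 2 * P - G).natDegree ≤ g + 1 := by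
      refine (natDegree_sub_le _ _).trans (max_le ?_ hG)
      rw [natDegree_le_iff_coeff_eq_zero]
      rintro (_ | _ | n) hn
      · omega
      · omega
      have e : (C z - X) ^ 2 * P = C (z ^ 2) * P - C (2 * z) * (X * P) + X * (X * P) := by
        simp only [C_mul, C_pow, C_ofNat]
        ring
      rw [e]
      simp only [coeff_sub, coeff_add, coeff_C_mul, coeff_X_mul, hP]
      rw [coeff_interpPoly ha (by omega), coeff_interpPoly ha (by omega),
        coeff_interpPoly ha (by omega)]
      ring
    rw [hL, h2] at h3
    omega
  obtain ⟨c1, c0, rfl⟩ := exists_eq_X_add_C_of_natDegree_le_one hLdeg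
  have e0 := congrArg (eval w) hL
  have e1 := congrArg (eval z) hL
  have e2 := congrArg (fun p => (derivative p).eval z) hL
  simp only [derivative_mul, derivative_sub, derivative_pow, derivative_add, derivative_C,
    derivative_X, eval_add, eval_mul, eval_sub, eval_pow, eval_C, eval_X, sub_self] at e0 e1 e2
  have e1' : c1 * z + c0 = - G.eval z / (nodalPoly a).eval z := by
    field_simp
    linear_combination -e1
  have e2' : c1 = (-(derivative G).eval z
      + (derivative (nodalPoly a)).eval z * G.eval z / (nodalPoly a).eval z)
        / (nodalPoly a).eval z := by
    rw [e1'] at e2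
    rw [eq_div_iff hNz]
    simp at e2
    linear_combination -e2
  have e3 : c1 * w + c0 = (c1 * z + c0) + c1 * (w - z) := by ring
  rw [e3, e1', e2'] at e0
  linear_combination e0

/-- The polynomials χ_{g-j-1} are the coefficients of the divided difference of ∏(X - r), as one
sees by expanding the product in elementary symmetric functions and each difference of powers as a
geometric sum. -/
theorem sum_pow_mul_chi (z x : ℂ) (hzx : z ≠ x) (s : Multiset ℂ) (hs : s.card + 1 = g) :
    ∑ j : Fin g, z ^ (j : ℕ) * chi ((g : ℤ) - ((j : ℕ) + 1) - 1) x s =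
      ((s.map fun r => z - r).prod - (s.map fun r => x - r).prod) / (z - x) := by
  have hprod : ∀ y : ℂ, (s.map fun r => y - r).prod =
      ∑ m ∈ Finset.range g, (-1) ^ m * s.esymm m * y ^ (g - 1 - m) := by
    intro y
    have := congrArg (eval y) (Multiset.prod_X_sub_X_eq_sum_esymm s)
    rw [eval_multiset_prod, Multiset.map_map] at this
    simp only [Function.comp_def, eval_sub, eval_X, eval_C] at this
    rw [this, eval_finsetSum, hs]
    refine Finset.sum_congr rfl fun m _ => ?_
    rw [show s.card - m = g - 1 - m by omega]
    simp
    ring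
  have hg : ∀ m ∈ Finset.range g, z ^ (g - 1 - m) - x ^ (g - 1 - m) =
      (∑ j ∈ Finset.range (g - 1 - m), z ^ j * x ^ (g - 1 - m - 1 - j)) * (z - x) := by
    intro m _
    exact (Commute.geom_sum₂_mul (Commute.all z x) _).symm
  rw [eq_div_iff (sub_ne_zero.2 hzx), hprod, hprod, ← Finset.sum_sub_distrib]
  -- Writing the range of j as a condition on j + m makes the double sum rectangular, so that the
  -- summations can be exchanged.
  have h1 : ∀ m ∈ Finset.range g, (-1) ^ m * s.esymm m * z ^ (g - 1 - m)
      - (-1) ^ m * s.esymm m * x ^ (g - 1 - m) =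
      (∑ j ∈ Finset.range g, if j + m + 2 ≤ g then
        (-1) ^ m * s.esymm m * (z ^ j * x ^ (g - 1 - m - 1 - j)) else 0) * (z - x) := by
    intro m hm
    rw [← mul_sub, hg m hm, ← Finset.sum_filter, ← mul_assoc, Finset.mul_sum]
    congr 1
    refine Finset.sum_congr ?_ fun _ _ => rfl
    ext j
    simp only [Finset.mem_range, Finset.mem_filter] at hm ⊢
    omega
  rw [Finset.sum_congr rfl h1, ← Finset.sum_mul, Finset.sum_comm, Finset.sum_range]
  congr 1
  refine Finset.sum_congr rfl fun j _ => ?_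
  rw [← Finset.sum_filter, chi, Finset.mul_sum]
  have := j.2
  refine Finset.sum_congr ?_ fun m hm => ?_
  · ext m
    simp only [Finset.mem_range, Finset.mem_filter]
    omega
  · simp only [Finset.mem_filter, Finset.mem_range] at hm
    rw [show ((g : ℤ) - ((j : ℕ) + 1) - 1 - m).toNat = g - 1 - m - 1 - j by omega]
    ring

/-- The part with F and V is what the flow can differentiate. The leftover sum of b_i/(z - a_i) is
cancelled in `sum_zetaForm` by an exact part of the second kind integrals. -/
theorem sum_pow_mul_chiSum (ha : Function.Injective a) {z : ℂ} (hz : ∀ i, z ≠ a i) :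
    ∑ j : Fin g, z ^ (j : ℕ) * chiSum j a b =
      (interpPoly a b).eval z * (derivative (nodalPoly a)).eval z / (nodalPoly a).eval z
        - (derivative (interpPoly a b)).eval z - ∑ i, b i / (z - a i) := by
  have hNz : (nodalPoly a).eval z ≠ 0 := Lagrange.eval_nodal_not_at_node fun i _ => hz i
  have hV : (derivative (interpPoly a b)).eval z =
      ∑ i, b i * (derivative (basisPoly a i)).eval z := by
    simp [Lagrange.interpolate_apply, eval_finsetSum]
  rw [eval_interpPoly, hV, Finset.sum_mul, Finset.sum_div, ← Finset.sum_sub_distrib,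
    ← Finset.sum_sub_distrib]
  simp only [chiSum, Finset.mul_sum]
  rw [Finset.sum_comm]
  refine Finset.sum_congr rfl fun i hi => ?_
  have hzi := sub_ne_zero.2 (hz i)
  have hd : derivF a i ≠ 0 :=
    Finset.prod_ne_zero_iff.2 fun r hr => sub_ne_zero.2 (ha.ne (Finset.ne_of_mem_erase hr).symm)
  have hw : Lagrange.nodalWeight Finset.univ a i = (derivF a i)⁻¹ := by
    rw [Lagrange.nodalWeight, derivF, Finset.prod_inv_distrib]
  have hcard : ((Finset.univ.erase i).val.map a).card + 1 = g := by
    rw [Multiset.card_map, Finset.card_val, Finset.card_erase_of_mem hi]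
    have := i.2
    simp
    omega
  have h := sum_pow_mul_chi z (a i) (hz i) _ hcard
  rw [Multiset.map_map, Multiset.map_map] at h
  have e1 : ∑ j : Fin g, z ^ (j : ℕ) * (b i * chi ((g : ℤ) - ((j : ℕ) + 1) - 1) (a i)
      ((Finset.univ.erase i).val.map a) / derivF a i) =
      b i / derivF a i * ∑ j : Fin g, z ^ (j : ℕ) * chi ((g : ℤ) - ((j : ℕ) + 1) - 1) (a i)
        ((Finset.univ.erase i).val.map a) := by
    rw [Finset.mul_sum]
    exact Finset.sum_congr rfl fun j _ => by ring
  have e2 : ((Finset.univ.erase i).val.map ((fun r => z - r) ∘ a)).prod * (z - a i) =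
      (nodalPoly a).eval z := by
    rw [Lagrange.eval_nodal, ← Finset.prod_erase_mul _ (fun r => z - a r) hi]
    rfl
  have e3 : ((Finset.univ.erase i).val.map ((fun r => a i - r) ∘ a)).prod = derivF a i := rfl
  have e4 : (basisPoly a i).eval z = (nodalPoly a).eval z * ((derivF a i)⁻¹ * (z - a i)⁻¹) := by
    rw [Lagrange.eval_basis_not_at_node hi (hz i), hw]
  have e5 : (derivative (basisPoly a i)).eval z * (z - a i) + (basisPoly a i).eval z =
      (derivF a i)⁻¹ * (derivative (nodalPoly a)).eval z := by
    have hb : basisPoly a i * (X - C (a i)) = C (derivF a i)⁻¹ * nodalPoly a := by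
      refine Polynomial.funext fun y => ?_
      by_cases hy : y = a i
      · simp [hy, Lagrange.eval_nodal_at_node hi]
      · rw [eval_mul, Lagrange.eval_basis_not_at_node hi hy, hw]
        have := sub_ne_zero.2 hy
        simp only [eval_sub, eval_X, eval_C, eval_mul]
        field_simp
    have := congrArg (fun p => (derivative p).eval z) hb
    simp only [derivative_mul, derivative_sub, derivative_X, derivative_C, eval_add, eval_mul,
      eval_sub, eval_X, eval_C, sub_zero, mul_one, zero_mul, zero_add] at this
    exact this
  rw [e1, h, e3]
  have e6 := eq_div_of_mul_eq hzi e2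
  have e7 : (derivative (basisPoly a i)).eval z = ((derivF a i)⁻¹ *
      (derivative (nodalPoly a)).eval z - (basisPoly a i).eval z) / (z - a i) := by
    rw [eq_div_iff hzi]
    linear_combination e5
  rw [e7, e6, e4]
  field_simp
  ring

end

/-- The final elimination for the generating function of the `℘_{jk}`. -/
theorem generating_identity (z w N N' Nw V V' Vw W W' Ww f f' n n' q q' P F l : ℂ)
    (hN : N ≠ 0) (hzw : w - z ≠ 0) (hf : f = V ^ 2 + N * W)
    (hf' : f' = 2 * V * V' + N' * W + N * W')
    (hn : (w - z) * n = N * Vw - V * Nw) (hn' : (w - z) * n' - n = N' * Vw - V' * Nw)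
    (hq : (w - z) * q = (Nw * W - N * Ww) / 2 + l / 2 * (w - z) * Nw * N)
    (hq' : (w - z) * q' - q = (Nw * W' - N' * Ww) / 2 - l / 2 * Nw * N
      + l / 2 * (w - z) * Nw * N')
    (hP : (z - w) ^ 2 * P = F - Nw / N * (2 * f + (w - z) * (f' - N' * (2 * f) / N))) :
    4 * (z - w) ^ 2 * (1 / 4 * P - 1 / 2 * ((q * N' + V * n') / N - V * N' * n / N ^ 2 - q')) =
      F - (2 * Vw * V + Nw * W + Ww * N) := by
  -- The flow relations and their z-derivatives are solved for n, n', q, q'. After f and f' are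
  -- eliminated too, the terms with N', V', W' and l drop out.
  have e1 : n = (N * Vw - V * Nw) / (w - z) := by rw [eq_div_iff hzw]; linear_combination hn
  have e2 : n' = (N' * Vw - V' * Nw + n) / (w - z) := by
    rw [eq_div_iff hzw]; linear_combination hn'
  have e3 : q = ((Nw * W - N * Ww) / 2 + l / 2 * (w - z) * Nw * N) / (w - z) := by
    rw [eq_div_iff hzw]; linear_combination hq
  have e4 : q' = ((Nw * W' - N' * Ww) / 2 - l / 2 * Nw * N
      + l / 2 * (w - z) * Nw * N' + q) / (w - z) := by
    rw [eq_div_iff hzw]; linear_combination hq'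
  have h : 4 * (z - w) ^ 2 * (1 / 4 * P - 1 / 2 * ((q * N' + V * n') / N - V * N' * n / N ^ 2 - q'))
      = (z - w) ^ 2 * P
        - 2 * (w - z) ^ 2 * ((q * N' + V * n') / N - V * N' * n / N ^ 2 - q') := by ring
  rw [h, hP, hf, hf', e2, e4, e1, e3]
  field_simp
  ring

end

end HyperWp

/-! ### The flow of F and V along (1, w, …, w^{g-1}). -/

namespace HyperWp
open Polynomial

noncomputable section

/-- A family of polynomials of bounded degree whose values depend differentiably on a parameter
has a directional derivative which is again a polynomial. -/
theorem exists_polynomial_fderiv {E : Type*} [NormedAddCommGroup E] [NormedSpace ℂ E]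
    {P : E → ℂ[X]} {u : E} (v : E) {n : ℕ} (hdeg : ∀ᶠ u' in nhds u, ∀ m, n ≤ m → (P u').coeff m = 0)
    (hP : ∀ z, DifferentiableAt ℂ (fun u' => (P u').eval z) u) :
    ∃ q : ℂ[X], (∀ m, n ≤ m → q.coeff m = 0) ∧
      (∀ z, fderiv ℂ (fun u' => (P u').eval z) u v = q.eval z) ∧
      (∀ z, DifferentiableAt ℂ (fun u' => (derivative (P u')).eval z) u) ∧
      (∀ z, fderiv ℂ (fun u' => (derivative (P u')).eval z) u v = (derivative q).eval z) ∧
      ∀ ξ : E → ℂ, DifferentiableAt ℂ ξ u → fderiv ℂ (fun u' => (P u').eval (ξ u')) u v =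
        q.eval (ξ u) + (derivative (P u)).eval (ξ u) * fderiv ℂ ξ u v := by
  -- Sampling at n fixed points 0, …, n - 1 makes the family, near u, a combination of fixed
  -- polynomials with differentiable coefficients.
  set c : Fin n → ℂ := fun i => (i : ℕ) with hc
  have hci : Function.Injective c := fun i j h => by
    have h' : ((i : ℕ) : ℂ) = ((j : ℕ) : ℂ) := h
    exact Fin.ext (by exact_mod_cast h')
  have hPe : ∀ᶠ u' in nhds u, P u' = ∑ i, C ((P u').eval (c i)) * basisPoly c i := by
    filter_upwards [hdeg] with u' hu'
    have := Lagrange.eq_interpolate (s := Finset.univ) (v := c) (f := P u') hci.injOn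
      (by simpa [degree_lt_iff_coeff_zero] using hu')
    rwa [Lagrange.interpolate_apply] at this
  have hval : ∀ z, (fun u' => (P u').eval z) =ᶠ[nhds u]
      fun u' => ∑ i, (P u').eval (c i) * (basisPoly c i).eval z := by
    intro z
    filter_upwards [hPe] with u' hu'
    conv_lhs => rw [hu']
    simp [eval_finsetSum]
  have hder : ∀ z, (fun u' => (derivative (P u')).eval z) =ᶠ[nhds u]
      fun u' => ∑ i, (P u').eval (c i) * (derivative (basisPoly c i)).eval z := by
    intro z
    filter_upwards [hPe] with u' hu'
    conv_lhs => rw [hu']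
    simp [eval_finsetSum]
  have hlin : ∀ r : Fin n → ℂ, HasFDerivAt (fun u' => ∑ i, (P u').eval (c i) * r i)
      (∑ i, r i • fderiv ℂ (fun u' => (P u').eval (c i)) u) u := fun r =>
    HasFDerivAt.fun_sum fun i _ => (hP (c i)).hasFDerivAt.mul_const (r i)
  refine ⟨∑ i, C (fderiv ℂ (fun u' => (P u').eval (c i)) u v) * basisPoly c i, ?_, ?_, ?_, ?_, ?_⟩
  · intro m hm
    rw [← Lagrange.interpolate_apply]
    exact coeff_interpPoly hci hm
  · intro z
    rw [(hval z).fderiv_eq, (hlin _).fderiv]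
    simp [eval_finsetSum, mul_comm]
  · intro z
    exact ((hder z).differentiableAt_iff).2 (hlin _).differentiableAt
  · intro z
    rw [(hder z).fderiv_eq, (hlin _).fderiv]
    simp [eval_finsetSum, mul_comm]
  · intro ξ hξ
    have h1 : (fun u' => (P u').eval (ξ u')) =ᶠ[nhds u]
        fun u' => ∑ i, (P u').eval (c i) * (basisPoly c i).eval (ξ u') := by
      filter_upwards [hPe] with u' hu'
      conv_lhs => rw [hu']
      simp [eval_finsetSum]
    have h2 : HasFDerivAt (fun u' => ∑ i, (P u').eval (c i) * (basisPoly c i).eval (ξ u'))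
        (∑ i, ((P u).eval (c i) • ((derivative (basisPoly c i)).eval (ξ u) • fderiv ℂ ξ u)
          + (basisPoly c i).eval (ξ u) • fderiv ℂ (fun u' => (P u').eval (c i)) u)) u :=
      HasFDerivAt.fun_sum fun i _ => (hP (c i)).hasFDerivAt.mul
        (((basisPoly c i).hasDerivAt (ξ u)).comp_hasFDerivAt u hξ.hasFDerivAt)
    rw [h1.fderiv_eq, h2.fderiv, (hder _).eq_of_nhds]
    simp only [eval_finsetSum, eval_mul, eval_C, sum_apply,
      add_apply, smul_apply, smul_eq_mul, Finset.sum_mul,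
      ← Finset.sum_add_distrib]
    exact Finset.sum_congr rfl fun i _ => by ring

/-- The direction `(1, w, …, w^{g-1})`. -/
def dir (g : ℕ) (w : ℂ) : Fin g → ℂ := fun k => w ^ (k : ℕ)

section

variable {g : ℕ} {lam : Fin (2 * g + 2) → ℂ} {U : Set (Fin g → ℂ)}
  {x y : Fin g → (Fin g → ℂ) → ℂ} {u : Fin g → ℂ}

namespace JacobiInversion

/-- Along this direction Jacobi's equations read ∑ x_i^k (dx_i/y_i) = w^k for k < g. The values
ℓ_i(w) solve the same Vandermonde system, whose solution is unique because the x_i are distinct. -/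
theorem fderiv_x (h : JacobiInversion lam U x y) (hu : u ∈ U) (w : ℂ) (i : Fin g) :
    fderiv ℂ (x i) u (dir g w) = y i u * (basisPoly (fun i => x i u) i).eval w := by
  have key := Matrix.eq_zero_of_forall_pow_sum_mul_pow_eq_zero (h.x_distinct u hu)
    (v := fun i => fderiv ℂ (x i) u (dir g w) / y i u - (basisPoly (fun i => x i u) i).eval w) ?_
  · have := congrFun key i
    have hy := h.y_ne_zero u hu i
    simp only [Pi.zero_apply, sub_eq_zero] at this
    rw [← this]
    field_simp
  · intro k
    have h1 := congrArg (fun φ => φ (dir g w)) (h.du_eq u hu k)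
    have h2 := pow_eq_sum_basisPoly (h.x_distinct u hu) w k
    simp only [ContinuousLinearMap.proj_apply, sum_apply,
      smul_apply, smul_eq_mul] at h1
    rw [show dir g w k = w ^ (k : ℕ) from rfl, h2, ← sub_eq_zero, ← Finset.sum_sub_distrib] at h1
    rw [← neg_eq_zero, ← Finset.sum_neg_distrib, ← h1]
    exact Finset.sum_congr rfl fun i _ => by ring

theorem differentiableAt_x (h : JacobiInversion lam U x y) (hu : u ∈ U) (i : Fin g) :
    DifferentiableAt ℂ (x i) u := (h.analytic_x i u hu).differentiableAt

theorem differentiableAt_y (h : JacobiInversion lam U x y) (hu : u ∈ U) (i : Fin g) :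
    DifferentiableAt ℂ (y i) u := (h.analytic_y i u hu).differentiableAt

theorem fderiv_y (h : JacobiInversion lam U x y) (hU : IsOpen U) (hu : u ∈ U) (v : Fin g → ℂ)
    (i : Fin g) : 2 * y i u * fderiv ℂ (y i) u v =
      (derivative (curvePoly lam)).eval (x i u) * fderiv ℂ (x i) u v := by
  have he : (fun u => y i u ^ 2) =ᶠ[nhds u] fun u => (curvePoly lam).eval (x i u) := by
    filter_upwards [hU.mem_nhds hu] with u' hu'
    rw [eval_curvePoly, h.on_curve u' hu']
  have h1 := ((h.differentiableAt_y hu i).hasFDerivAt.pow 2).fderiv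
  have h2 := (((curvePoly lam).hasDerivAt (x i u)).comp_hasFDerivAt u
    (h.differentiableAt_x hu i).hasFDerivAt).fderiv
  have h3 := congrArg (fun φ => φ v) (he.fderiv_eq (𝕜 := ℂ))
  simp only [Function.comp_def] at h2
  rw [h1, h2] at h3
  simpa using h3

theorem differentiableAt_nodalPoly (h : JacobiInversion lam U x y) (hu : u ∈ U) (z : ℂ) :
    DifferentiableAt ℂ (fun u => (nodalPoly fun i => x i u).eval z) u := by
  simp only [Lagrange.eval_nodal]
  exact (HasFDerivAt.finsetProd fun i _ =>
    ((h.differentiableAt_x hu i).const_sub z).hasFDerivAt).differentiableAt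

theorem differentiableAt_interpPoly (h : JacobiInversion lam U x y) (hu : u ∈ U) (z : ℂ) :
    DifferentiableAt ℂ (fun u => (interpPoly (fun i => x i u) fun i => y i u).eval z) u := by
  simp only [eval_interpPoly, Lagrange.basis, Lagrange.basisDivisor, eval_prod, eval_mul, eval_C,
    eval_sub, eval_X]
  refine DifferentiableAt.fun_sum fun i _ => (h.differentiableAt_y hu i).mul
    (HasFDerivAt.finsetProd fun j hj => (DifferentiableAt.fun_mul
      (DifferentiableAt.fun_inv ((h.differentiableAt_x hu i).fun_sub (h.differentiableAt_x hu j)) ?_)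
      ((h.differentiableAt_x hu j).const_sub z)).hasFDerivAt).differentiableAt
  exact sub_ne_zero.2 ((h.x_distinct u hu).ne (Finset.ne_of_mem_erase hj).symm)

/-- The flow of the polynomial `F` in the direction `(1, w, …, w^{g-1})`. -/
theorem exists_flow_nodalPoly (h : JacobiInversion lam U x y) (hu : u ∈ U) {w : ℂ}
    (hw : ∀ i, w ≠ x i u) : ∃ n : ℂ[X],
      (∀ z, fderiv ℂ (fun u => (nodalPoly fun i => x i u).eval z) u (dir g w) = n.eval z) ∧
      (∀ z, DifferentiableAt ℂ (fun u => (derivative (nodalPoly fun i => x i u)).eval z) u) ∧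
      (∀ z, fderiv ℂ (fun u => (derivative (nodalPoly fun i => x i u)).eval z) u (dir g w) =
        (derivative n).eval z) ∧
      (C w - X) * n = nodalPoly (fun i => x i u)
          * C ((interpPoly (fun i => x i u) fun i => y i u).eval w)
        - interpPoly (fun i => x i u) (fun i => y i u)
          * C ((nodalPoly fun i => x i u).eval w) := by
  obtain ⟨n, -, h1, h2, h3, -⟩ := exists_polynomial_fderiv (P := fun u => nodalPoly fun i => x i u)
    (u := u) (dir g w) (n := g + 1) (Filter.Eventually.of_forall fun u' m hm =>
      coeff_eq_zero_of_natDegree_lt (by rw [natDegree_nodalPoly]; omega))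
    (h.differentiableAt_nodalPoly hu)
  refine ⟨n, h1, h2, h3, ?_⟩
  -- `nodalPoly_flow` needs z away from the nodes; infinitely many such z suffice for an identity of
  -- polynomials.
  refine eq_of_infinite_eval_eq _ _ ((Set.finite_range fun i => x i u).infinite_compl.mono ?_)
  intro z hz
  have hz' : ∀ i, z ≠ x i u := fun i hi => hz ⟨i, hi.symm⟩
  have hD : HasFDerivAt (fun u => ∏ i, (z - x i u))
      (∑ i, (∏ j ∈ Finset.univ.erase i, (z - x j u)) • (0 - fderiv ℂ (x i) u)) u :=
    HasFDerivAt.finsetProd fun i _ =>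
      (hasFDerivAt_const z u).fun_sub (h.differentiableAt_x hu i).hasFDerivAt
  have h4 := h1 z
  simp only [Lagrange.eval_nodal] at h4
  rw [hD.fderiv] at h4
  have h5 := nodalPoly_flow (b := fun i => y i u) hw hz'
  simp only [Set.mem_ofPred_eq, eval_mul, eval_sub, eval_C, eval_X]
  rw [← h4, ← neg_inj, neg_sub, ← h5, ← mul_neg]
  congr 1
  simp only [sum_apply, smul_apply,
    sub_apply, zero_apply, h.fderiv_x hu,
    ← Finset.sum_neg_distrib, smul_eq_mul]
  exact Finset.sum_congr rfl fun i _ => by ring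

/-- The flow of the interpolating polynomial in the direction `(1, w, …, w^{g-1})`. -/
theorem exists_flow_interpPoly (h : JacobiInversion lam U x y) (hU : IsOpen U) (hu : u ∈ U) {w : ℂ}
    (hw : ∀ i, w ≠ x i u) : ∃ q : ℂ[X],
      (∀ z, fderiv ℂ (fun u => (interpPoly (fun i => x i u) fun i => y i u).eval z) u (dir g w) =
        q.eval z) ∧
      (∀ z, DifferentiableAt ℂ
        (fun u => (derivative (interpPoly (fun i => x i u) fun i => y i u)).eval z) u) ∧
      (∀ z, fderiv ℂ (fun u => (derivative (interpPoly (fun i => x i u) fun i => y i u)).eval z) u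
        (dir g w) = (derivative q).eval z) ∧
      (C w - X) * q = C (1 / 2) * (C ((nodalPoly fun i => x i u).eval w)
            * coPoly lam (fun i => x i u) (fun i => y i u)
          - nodalPoly (fun i => x i u)
            * C ((coPoly lam (fun i => x i u) (fun i => y i u)).eval w))
        + C (coef lam (2 * g + 1) / 2 * (nodalPoly fun i => x i u).eval w)
          * ((C w - X) * nodalPoly fun i => x i u) := by
  obtain ⟨q, h0, h1, h2, h3, h4⟩ := exists_polynomial_fderiv
    (P := fun u => interpPoly (fun i => x i u) fun i => y i u) (u := u) (dir g w) (n := g)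
    (by filter_upwards [hU.mem_nhds hu] with u' hu' m hm
        exact coeff_interpPoly (h.x_distinct u' hu') hm)
    (h.differentiableAt_interpPoly hu)
  refine ⟨q, h1, h2, h3, ?_⟩
  refine Polynomial.funext fun z => ?_
  have := interpPoly_flow (lam := lam) (h.x_distinct u hu) (h.on_curve u hu) (h.y_ne_zero u hu) h0
    hw (da := fun i => fderiv ℂ (x i) u (dir g w)) (db := fun i => fderiv ℂ (y i) u (dir g w))
    (fun i => h.fderiv_x hu w i) (fun i => h.fderiv_y hU hu _ i) (fun i => ?_) z
  · simp only [eval_add, eval_mul, eval_sub, eval_C, eval_X]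
    rw [this]
    ring
  -- Differentiate V(x_i) = y_i, which holds in a neighbourhood of u, with both V and x_i moving.
  · rw [← h4 _ (h.differentiableAt_x hu i)]
    refine congrArg (fun φ : (Fin g → ℂ) →L[ℂ] ℂ => φ (dir g w)) (Filter.EventuallyEq.fderiv_eq ?_)
    filter_upwards [hU.mem_nhds hu] with u' hu'
    exact eval_interpPoly_node (h.x_distinct u' hu') i

end JacobiInversion

end

end

end HyperWp

/-! ### The closed formula for the generating function of the ℘_{jk}. -/

namespace HyperWp
open Polynomial

noncomputable section

theorem hasDerivAt_line {E : Type*} [NormedAddCommGroup E] [NormedSpace ℂ E] {φ : E → ℂ} {u : E}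
    (h : DifferentiableAt ℂ φ u) (v : E) :
    HasDerivAt (fun t : ℂ => φ (u + t • v)) (fderiv ℂ φ u v) 0 :=
  h.hasFDerivAt.hasLineDerivAt v

/-- Directional derivatives can thus be computed by one-variable calculus from a formula valid only
near u. -/
theorem fderiv_eq_of_hasDerivAt_line {E : Type*} [NormedAddCommGroup E] [NormedSpace ℂ E]
    {φ ψ : E → ℂ} {u v : E} {d : ℂ} (h : DifferentiableAt ℂ φ u) (hψ : φ =ᶠ[nhds u] ψ)
    (hd : HasDerivAt (fun t : ℂ => ψ (u + t • v)) d 0) : fderiv ℂ φ u v = d := by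
  refine (hasDerivAt_line h v).unique (hd.congr_of_eventuallyEq ?_)
  have : Filter.Tendsto (fun t : ℂ => u + t • v) (nhds 0) (nhds u) := by
    have : ContinuousAt (fun t : ℂ => u + t • v) 0 := by fun_prop
    simpa [ContinuousAt] using this
  exact this.eventually hψ

section

variable {g : ℕ} {lam : Fin (2 * g + 2) → ℂ} {U : Set (Fin g → ℂ)}
  {x y : Fin g → (Fin g → ℂ) → ℂ} {u : Fin g → ℂ}

namespace JacobiInversion

theorem differentiableAt_chiSum (h : JacobiInversion lam U x y) (hu : u ∈ U) (j : Fin g) :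
    DifferentiableAt ℂ (fun v => chiSum j (fun i => x i v) fun i => y i v) u := by
  have hx := h.differentiableAt_x hu
  have hy := h.differentiableAt_y hu
  have hprod : ∀ (s : Finset (Fin g)) (φ : Fin g → (Fin g → ℂ) → ℂ),
      (∀ i, DifferentiableAt ℂ (φ i) u) → DifferentiableAt ℂ (fun v => ∏ i ∈ s, φ i v) u :=
    fun s φ hφ => (HasFDerivAt.finsetProd fun i _ => (hφ i).hasFDerivAt).differentiableAt
  simp only [chiSum, chi, div_eq_mul_inv]
  refine DifferentiableAt.fun_sum fun i _ => ?_
  refine DifferentiableAt.fun_mul (DifferentiableAt.fun_mul (hy i) ?_)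
    (DifferentiableAt.fun_inv ?_ ?_)
  · refine DifferentiableAt.fun_sum fun m _ => DifferentiableAt.fun_mul
      (DifferentiableAt.fun_mul (differentiableAt_const _) ?_) ((hx i).fun_pow _)
    simp only [Finset.esymm_map_val]
    exact DifferentiableAt.fun_sum fun t _ => hprod t _ hx
  · exact hprod _ (fun r v => x i v - x r v) fun r => (hx i).fun_sub (hx r)
  · exact Finset.prod_ne_zero_iff.2 fun r hr =>
      sub_ne_zero.2 ((h.x_distinct u hu).ne (Finset.ne_of_mem_erase hr).symm)

theorem eventually_ne (h : JacobiInversion lam U x y) (hu : u ∈ U) {z : ℂ}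
    (hz : ∀ i, z ≠ x i u) : ∀ᶠ v in nhds u, ∀ i, z ≠ x i v := by
  rw [Filter.eventually_all]
  intro i
  exact ((h.differentiableAt_x hu i).continuousAt.eventually_ne (hz i).symm).mono
    fun v hv => hv.symm

/-- The generating function of the `℘_{jk}` on the part where Jacobi's problem is solved. -/
theorem sum_zetaForm (h : JacobiInversion lam U x y) (hU : IsOpen U) (hu : u ∈ U) {z w : ℂ}
    (hz : ∀ i, z ≠ x i u) (hw : ∀ i, w ≠ x i u) (hzw : z ≠ w) :
    4 * (z - w) ^ 2 * ∑ j : Fin g, z ^ (j : ℕ) * zetaForm lam x y j u (dir g w) =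
      polar g (coef lam) z w -
        (2 * (interpPoly (fun i => x i u) fun i => y i u).eval w
            * (interpPoly (fun i => x i u) fun i => y i u).eval z
          + (nodalPoly fun i => x i u).eval w
            * (coPoly lam (fun i => x i u) fun i => y i u).eval z
          + (coPoly lam (fun i => x i u) fun i => y i u).eval w
            * (nodalPoly fun i => x i u).eval z) := by
  have ha := h.x_distinct u hu
  have hN : (nodalPoly fun i => x i u).eval z ≠ 0 :=
    Lagrange.eval_nodal_not_at_node fun i _ => hz i
  obtain ⟨n, hn1, hn2, hn3, hn⟩ := h.exists_flow_nodalPoly hu hw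
  obtain ⟨q, hq1, hq2, hq3, hq⟩ := h.exists_flow_interpPoly hU hu hw
  -- T is the generating function of the sums under the exact differential in the forms d(-ζ_j).
  set T : (Fin g → ℂ) → ℂ := fun v =>
    ∑ j : Fin g, z ^ (j : ℕ) * chiSum j (fun i => x i v) fun i => y i v with hT
  have hTd : DifferentiableAt ℂ T u := DifferentiableAt.fun_sum fun j _ =>
    (h.differentiableAt_chiSum hu j).const_mul _
  have hTe : T =ᶠ[nhds u] fun v => (interpPoly (fun i => x i v) fun i => y i v).eval z
      * (derivative (nodalPoly fun i => x i v)).eval z / (nodalPoly fun i => x i v).eval z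
      - (derivative (interpPoly (fun i => x i v) fun i => y i v)).eval z
      - ∑ i, y i v / (z - x i v) := by
    filter_upwards [hU.mem_nhds hu, h.eventually_ne hu hz] with v hv hzv
    exact sum_pow_mul_chiSum (h.x_distinct v hv) hzv
  have hder := fderiv_eq_of_hasDerivAt_line (v := dir g w) hTd hTe
    (((((hasDerivAt_line (h.differentiableAt_interpPoly hu z) (dir g w)).fun_mul
      (hasDerivAt_line (hn2 z) (dir g w))).fun_div
      (hasDerivAt_line (h.differentiableAt_nodalPoly hu z) (dir g w)) (by simpa using hN)).fun_sub
      (hasDerivAt_line (hq2 z) (dir g w))).fun_sub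
      (HasDerivAt.fun_sum fun i _ =>
        (hasDerivAt_line (h.differentiableAt_y hu i) (dir g w)).fun_div
          ((hasDerivAt_line (h.differentiableAt_x hu i) (dir g w)).const_sub z)
          (by simpa using sub_ne_zero.2 (hz i))))
  simp only [zero_smul, add_zero, hn1, hn3, hq1, hq3] at hder
  have hdy : ∀ i, fderiv ℂ (y i) u (dir g w) = (derivative (curvePoly lam)).eval (x i u)
      * (basisPoly (fun i => x i u) i).eval w / 2 := by
    intro i
    have h1 := h.fderiv_y hU hu (dir g w) i
    rw [h.fderiv_x hu] at h1
    have := h.y_ne_zero u hu i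
    have h2 : (2 * y i u) * fderiv ℂ (y i) u (dir g w) = (2 * y i u) *
        ((derivative (curvePoly lam)).eval (x i u) * (basisPoly (fun i => x i u) i).eval w / 2) := by
      rw [h1]; ring
    exact mul_left_cancel₀ (by simpa using this) h2
  have hP := eval_interpPoly_div_sq ha (natDegree_polarPoly_le (coef lam) z) hz w
  simp only [eval_polarPoly, eval_derivative_polarPoly, polar_self] at hP
  have hsum : ∑ j : Fin g, z ^ (j : ℕ) * zetaForm lam x y j u (dir g w) =
      1 / 4 * (∑ i, secondKind g (coef lam) z (x i u) * (basisPoly (fun i => x i u) i).eval w)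
        - 1 / 2 * fderiv ℂ T u (dir g w) := by
    have hTf : fderiv ℂ T u (dir g w) = ∑ j : Fin g, z ^ (j : ℕ) *
        fderiv ℂ (fun v => chiSum j (fun i => x i v) fun i => y i v) u (dir g w) := by
      rw [hT, fderiv_fun_sum fun j _ => (h.differentiableAt_chiSum hu j).const_mul _,
        sum_apply]
      refine Finset.sum_congr rfl fun j _ => ?_
      rw [fderiv_const_mul (h.differentiableAt_chiSum hu j)]
      rfl
    have hS : ∀ i, secondKind g (coef lam) z (x i u) * (basisPoly (fun i => x i u) i).eval w =
        ∑ j : Fin g, z ^ (j : ℕ) *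
          ((∑ k ∈ Finset.Icc ((j : ℕ) + 1) (2 * g + 1 - ((j : ℕ) + 1)),
            ((k : ℂ) + 1 - (((j : ℕ) : ℂ) + 1)) * coef lam (k + 1 + ((j : ℕ) + 1)) * x i u ^ k)
              / y i u * (y i u * (basisPoly (fun i => x i u) i).eval w)) := by
      intro i
      have := h.y_ne_zero u hu i
      rw [secondKind, Finset.sum_range, Finset.sum_mul]
      refine Finset.sum_congr rfl fun j _ => ?_
      field_simp
    rw [hTf, Finset.sum_congr rfl fun i _ => hS i, Finset.sum_comm, Finset.mul_sum, Finset.mul_sum,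
      ← Finset.sum_sub_distrib]
    refine Finset.sum_congr rfl fun j _ => ?_
    simp only [zetaForm, sub_apply, smul_apply, sum_apply, smul_eq_mul, h.fderiv_x hu,
      Finset.mul_sum]
    rw [mul_sub, Finset.mul_sum]
    congr 1
    · exact Finset.sum_congr rfl fun i _ => by ring
    · ring
  have hmain : ∑ j : Fin g, z ^ (j : ℕ) * zetaForm lam x y j u (dir g w) =
      1 / 4 * (interpPoly (fun i => x i u)
          fun i => polar g (coef lam) z (x i u) / (z - x i u) ^ 2).eval w
        - 1 / 2 * ((q.eval z * (derivative (nodalPoly fun i => x i u)).eval z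
            + (interpPoly (fun i => x i u) fun i => y i u).eval z * (derivative n).eval z)
              / (nodalPoly fun i => x i u).eval z
          - (interpPoly (fun i => x i u) fun i => y i u).eval z
            * (derivative (nodalPoly fun i => x i u)).eval z * n.eval z
              / (nodalPoly fun i => x i u).eval z ^ 2 - (derivative q).eval z) := by
    rw [hsum, hder, eval_interpPoly fun i => polar g (coef lam) z (x i u) / (z - x i u) ^ 2]
    -- By the Taylor formula and y² = f(x), the second kind integrand differs from `polar`/(z -
    -- x_i)² by twice the derivative of y_i/(z - x_i). This is the term that cancels the leftover of
    -- `sum_pow_mul_chiSum`.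
    have hi : ∀ i, polar g (coef lam) z (x i u) / (z - x i u) ^ 2
          * (basisPoly (fun i => x i u) i).eval w =
        secondKind g (coef lam) z (x i u) * (basisPoly (fun i => x i u) i).eval w
        + 2 * ((fderiv ℂ (y i) u (dir g w) * (z - x i u)
            - y i u * -fderiv ℂ (x i) u (dir g w)) / (z - x i u) ^ 2) := by
      intro i
      have h1 := secondKind_coef (lam := lam) z (x i u)
      rw [hdy, h.fderiv_x hu]
      have h2 := sub_ne_zero.2 (hz i)
      field_simp
      have h3 := h.on_curve u hu i
      linear_combination -(basisPoly (fun i => x i u) i).eval w * h1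
        - 2 * (basisPoly (fun i => x i u) i).eval w * h3
    rw [Finset.sum_congr rfl fun i _ => hi i, Finset.sum_add_distrib, ← Finset.mul_sum]
    field_simp
    ring
  rw [hmain]
  -- The hypotheses of `generating_identity` are the relation f = V² + FW and the two flow
  -- equations, together with their z-derivatives.
  have hf := congrArg (eval z) (nodalPoly_mul_coPoly ha (h.on_curve u hu))
  have hf' := congrArg (fun p => (derivative p).eval z)
    (nodalPoly_mul_coPoly ha (h.on_curve u hu))
  have e1 := congrArg (eval z) hn
  have e2 := congrArg (fun p => (derivative p).eval z) hn
  have e3 := congrArg (eval z) hq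
  have e4 := congrArg (fun p => (derivative p).eval z) hq
  simp only [derivative_mul, derivative_sub, derivative_add, derivative_C, derivative_X,
    derivative_pow, eval_add, eval_mul, eval_sub, eval_pow, eval_C, eval_X, eval_zero, eval_one,
    eval_curvePoly] at hf hf' e1 e2 e3 e4
  have hf1 : curveF lam z = (interpPoly (fun i => x i u) fun i => y i u).eval z ^ 2
      + (nodalPoly fun i => x i u).eval z
        * (coPoly lam (fun i => x i u) fun i => y i u).eval z := by
    linear_combination -hf
  norm_num [-Lagrange.interpolate_apply] at hf'
  exact generating_identity (V' := (derivative (interpPoly (fun i => x i u) fun i => y i u)).eval z)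
    (W' := (derivative (coPoly lam (fun i => x i u) fun i => y i u)).eval z)
    (f := curveF lam z) (f' := (derivative (curvePoly lam)).eval z) (l := coef lam (2 * g + 1))
    (hN := hN) (hzw := sub_ne_zero.2 hzw.symm) (hf := hf1) (hf' := by linear_combination -hf')
    (hn := e1) (hn' := by linear_combination e2) (hq := by linear_combination e3)
    (hq' := by linear_combination e4) (hP := hP) ..

end JacobiInversion

end

end

end HyperWp

/-! ### Derivatives of the generating function and the equations at generic arguments. -/

namespace HyperWp
open Polynomial

noncomputable section

theorem bil_comm {K : Type*} [Field K] (p q : K × K × K) : bil p q = bil q p := by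
  simp only [bil]
  ring

/-- The values `(F(z), V(z), W(z))`. -/
def triple {g : ℕ} (lam : Fin (2 * g + 2) → ℂ) (x y : Fin g → (Fin g → ℂ) → ℂ) (z : ℂ)
    (u : Fin g → ℂ) : ℂ × ℂ × ℂ :=
  ((nodalPoly fun i => x i u).eval z, (interpPoly (fun i => x i u) fun i => y i u).eval z,
    (coPoly lam (fun i => x i u) fun i => y i u).eval z)

/-- The generating function `∑_{j,k} ℘_{jk} z^{j-1} w^{k-1}`. -/
def gen {g : ℕ} (ζ : Fin g → (Fin g → ℂ) → ℂ) (z w : ℂ) (u : Fin g → ℂ) : ℂ :=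
  ∑ j : Fin g, z ^ (j : ℕ) * fderiv ℂ (fun v => -ζ j v) u (dir g w)

theorem analyticAt_fderiv_apply {E : Type*} [NormedAddCommGroup E] [NormedSpace ℂ E]
    {φ : E → ℂ} {u : E} (h : AnalyticAt ℂ φ u) (v : E) :
    AnalyticAt ℂ (fun u => fderiv ℂ φ u v) u :=
  ((ContinuousLinearMap.apply ℂ ℂ v).analyticAt _).comp h.fderiv

theorem analyticAt_gen {g : ℕ} {ζ : Fin g → (Fin g → ℂ) → ℂ} {u : Fin g → ℂ}
    (hζ : ∀ j, AnalyticAt ℂ (ζ j) u) (z w : ℂ) : AnalyticAt ℂ (gen ζ z w) u :=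
  Finset.analyticAt_fun_sum _ fun j _ =>
    analyticAt_const.fun_mul (analyticAt_fderiv_apply (hζ j).neg _)

section

variable {g : ℕ} {lam : Fin (2 * g + 2) → ℂ} {U : Set (Fin g → ℂ)}
  {x y : Fin g → (Fin g → ℂ) → ℂ} {u : Fin g → ℂ}

namespace JacobiInversion

/-- The flow of the triple `(F(z), V(z), W(z))`. -/
theorem hasDerivAt_triple (h : JacobiInversion lam U x y) (hU : IsOpen U) (hu : u ∈ U) {z w : ℂ}
    (hz : ∀ i, z ≠ x i u) (hw : ∀ i, w ≠ x i u) (hzw : w - z ≠ 0) :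
    HasDerivAt (fun t : ℂ => (triple lam x y z (u + t • dir g w)).1)
      (flow (coef lam (2 * g + 1)) w z (triple lam x y w u) (triple lam x y z u)).1 0 ∧
    HasDerivAt (fun t : ℂ => (triple lam x y z (u + t • dir g w)).2.1)
      (flow (coef lam (2 * g + 1)) w z (triple lam x y w u) (triple lam x y z u)).2.1 0 ∧
    HasDerivAt (fun t : ℂ => (triple lam x y z (u + t • dir g w)).2.2)
      (flow (coef lam (2 * g + 1)) w z (triple lam x y w u) (triple lam x y z u)).2.2 0 := by
  have hN : (nodalPoly fun i => x i u).eval z ≠ 0 :=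
    Lagrange.eval_nodal_not_at_node fun i _ => hz i
  obtain ⟨n, hn1, -, -, hn⟩ := h.exists_flow_nodalPoly hu hw
  obtain ⟨q, hq1, -, -, hq⟩ := h.exists_flow_interpPoly hU hu hw
  have e1 := congrArg (eval z) hn
  have e2 := congrArg (eval z) hq
  simp only [eval_add, eval_mul, eval_sub, eval_C, eval_X] at e1 e2
  have h1 : HasDerivAt (fun t : ℂ => (triple lam x y z (u + t • dir g w)).1)
      (flow (coef lam (2 * g + 1)) w z (triple lam x y w u) (triple lam x y z u)).1 0 := by
    refine (hasDerivAt_line (h.differentiableAt_nodalPoly hu z) (dir g w)).congr_deriv ?_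
    rw [hn1]
    simp only [flow, triple]
    rw [eq_div_iff hzw]
    linear_combination e1
  have h2 : HasDerivAt (fun t : ℂ => (triple lam x y z (u + t • dir g w)).2.1)
      (flow (coef lam (2 * g + 1)) w z (triple lam x y w u) (triple lam x y z u)).2.1 0 := by
    refine (hasDerivAt_line (h.differentiableAt_interpPoly hu z) (dir g w)).congr_deriv ?_
    rw [hq1]
    simp only [flow, triple]
    field_simp
    linear_combination 2 * e2
  refine ⟨h1, h2, ?_⟩
  have hline : Filter.Tendsto (fun t : ℂ => u + t • dir g w) (nhds 0) (nhds u) := by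
    have : ContinuousAt (fun t : ℂ => u + t • dir g w) 0 := by fun_prop
    simpa [ContinuousAt] using this
  have hN0 : (triple lam x y z (u + (0 : ℂ) • dir g w)).1 ≠ 0 := by simpa [triple] using hN
  -- Near u one has W(z) = (f(z) - V(z)²)/F(z) with f(z) independent of u, so the flow of W follows
  -- from those of F and V.
  have h3 := ((h2.fun_pow 2).const_sub (curveF lam z)).fun_div h1 hN0
  refine (h3.congr_of_eventuallyEq ?_).congr_deriv ?_
  · filter_upwards [hline.eventually (hU.mem_nhds hu), h1.continuousAt.eventually_ne hN0]
      with t ht hne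
    have := congrArg (eval z) (nodalPoly_mul_coPoly (h.x_distinct _ ht) (h.on_curve _ ht))
    simp only [eval_sub, eval_mul, eval_pow, eval_curvePoly] at this
    rw [eq_div_iff hne, mul_comm]
    exact this
  · have hf := congrArg (eval z) (nodalPoly_mul_coPoly (h.x_distinct u hu) (h.on_curve u hu))
    simp only [eval_sub, eval_mul, eval_pow, eval_curvePoly] at hf
    have hf' : curveF lam z = (triple lam x y z u).2.1 ^ 2
        + (triple lam x y z u).1 * (triple lam x y z u).2.2 := by
      simp only [triple]
      linear_combination -hf
    have hN' : (triple lam x y z u).1 ≠ 0 := hN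
    simp only [zero_smul, add_zero]
    rw [hf']
    simp only [flow]
    field_simp
    ring

variable {ζ : Fin g → (Fin g → ℂ) → ℂ}

theorem gen_eq (h : JacobiInversion lam U x y) (hU : IsOpen U)
    (hd : ∀ u ∈ U, ∀ j, fderiv ℂ (fun v => -ζ j v) u = zetaForm lam x y j u)
    (hu : u ∈ U) {z w : ℂ} (hz : ∀ i, z ≠ x i u) (hw : ∀ i, w ≠ x i u) (hzw : z ≠ w) :
    gen ζ z w u = (polar g (coef lam) z w - bil (triple lam x y z u) (triple lam x y w u))
      / (4 * (z - w) ^ 2) := by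
  have h1 := h.sum_zetaForm hU hu hz hw hzw
  have h2 : (4 * (z - w) ^ 2 : ℂ) ≠ 0 :=
    mul_ne_zero (by norm_num) (pow_ne_zero _ (sub_ne_zero.2 hzw))
  rw [eq_div_iff h2, gen, mul_comm]
  simp only [hd u hu]
  rw [h1]
  simp only [bil, triple]
  ring

/-- In `gen_eq` only the `bil` term depends on u, and `bil_flow` differentiates it; its factor a - b
cancels one of the two in the denominator. -/
theorem fderiv_gen (h : JacobiInversion lam U x y) (hU : IsOpen U)
    (hζ : ∀ j, AnalyticOnNhd ℂ (ζ j) U)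
    (hd : ∀ u ∈ U, ∀ j, fderiv ℂ (fun v => -ζ j v) u = zetaForm lam x y j u)
    (hu : u ∈ U) {a b c : ℂ} (ha : ∀ i, a ≠ x i u) (hb : ∀ i, b ≠ x i u) (hc : ∀ i, c ≠ x i u)
    (hab : a - b ≠ 0) (hca : c - a ≠ 0) (hcb : c - b ≠ 0) :
    fderiv ℂ (gen ζ a b) u (dir g c) =
      det3 (triple lam x y a u) (triple lam x y b u) (triple lam x y c u)
        / (4 * (a - b) * (c - a) * (c - b)) := by
  obtain ⟨a1, a2, a3⟩ := h.hasDerivAt_triple hU hu ha hc hca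
  obtain ⟨b1, b2, b3⟩ := h.hasDerivAt_triple hU hu hb hc hcb
  refine fderiv_eq_of_hasDerivAt_line
    (analyticAt_gen (fun j => hζ j u hu) a b).differentiableAt
    (ψ := fun v => (polar g (coef lam) a b - bil (triple lam x y a v) (triple lam x y b v))
      / (4 * (a - b) ^ 2)) ?_ ?_
  · filter_upwards [hU.mem_nhds hu, h.eventually_ne hu ha, h.eventually_ne hu hb] with v hv h1 h2
    exact h.gen_eq hU hd hv h1 h2 (sub_ne_zero.1 hab)
  · simp only [bil]
    refine (((((a2.const_mul 2).fun_mul b2).fun_add (a1.fun_mul b3)).fun_add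
      (a3.fun_mul b1)).const_sub _ |>.div_const _).congr_deriv ?_
    simp only [zero_smul, add_zero]
    have := bil_flow a b c (coef lam (2 * g + 1)) (triple lam x y a u) (triple lam x y b u)
      (triple lam x y c u) hca hcb
    have e : det3 (triple lam x y a u) (triple lam x y b u) (triple lam x y c u)
        / (4 * (a - b) * (c - a) * (c - b)) =
        -(-det3 (triple lam x y a u) (triple lam x y b u) (triple lam x y c u) * (a - b)
          / ((c - a) * (c - b))) / (4 * (a - b) ^ 2) := by
      field_simp
    rw [e, ← this]
    simp only [bil]
    ring

/-- Differentiate the determinant of `fderiv_gen` by `det3_flow`; the denominators there are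
constants. -/
theorem fderiv_fderiv_gen (h : JacobiInversion lam U x y) (hU : IsOpen U)
    (hζ : ∀ j, AnalyticOnNhd ℂ (ζ j) U)
    (hd : ∀ u ∈ U, ∀ j, fderiv ℂ (fun v => -ζ j v) u = zetaForm lam x y j u)
    (hu : u ∈ U) {a b c d : ℂ} (ha : ∀ i, a ≠ x i u) (hb : ∀ i, b ≠ x i u) (hc : ∀ i, c ≠ x i u)
    (hd' : ∀ i, d ≠ x i u) (hab : a - b ≠ 0) (hca : c - a ≠ 0) (hcb : c - b ≠ 0)
    (hda : d - a ≠ 0) (hdb : d - b ≠ 0) (hdc : d - c ≠ 0) :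
    fderiv ℂ (fun v => fderiv ℂ (gen ζ a b) v (dir g c)) u (dir g d) =
      ((bil (triple lam x y d u) (triple lam x y b u) * bil (triple lam x y a u) (triple lam x y c u)
        - bil (triple lam x y d u) (triple lam x y c u)
          * bil (triple lam x y a u) (triple lam x y b u)) / (d - a)
      + (bil (triple lam x y d u) (triple lam x y c u)
          * bil (triple lam x y b u) (triple lam x y a u)
        - bil (triple lam x y d u) (triple lam x y a u)
          * bil (triple lam x y b u) (triple lam x y c u)) / (d - b)
      + (bil (triple lam x y d u) (triple lam x y a u)
          * bil (triple lam x y c u) (triple lam x y b u)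
        - bil (triple lam x y d u) (triple lam x y b u)
          * bil (triple lam x y c u) (triple lam x y a u)) / (d - c)) / 2
        / (4 * (a - b) * (c - a) * (c - b)) := by
  obtain ⟨a1, a2, a3⟩ := h.hasDerivAt_triple hU hu ha hd' hda
  obtain ⟨b1, b2, b3⟩ := h.hasDerivAt_triple hU hu hb hd' hdb
  obtain ⟨c1, c2, c3⟩ := h.hasDerivAt_triple hU hu hc hd' hdc
  refine fderiv_eq_of_hasDerivAt_line
    (analyticAt_fderiv_apply (analyticAt_gen (fun j => hζ j u hu) a b) _).differentiableAt
    (ψ := fun v => det3 (triple lam x y a v) (triple lam x y b v) (triple lam x y c v)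
        / (4 * (a - b) * (c - a) * (c - b))) ?_ ?_
  · filter_upwards [hU.mem_nhds hu, h.eventually_ne hu ha, h.eventually_ne hu hb,
      h.eventually_ne hu hc] with v hv h1 h2 h3
    exact h.fderiv_gen hU hζ hd hv h1 h2 h3 hab hca hcb
  · simp only [det3]
    refine HasDerivAt.div_const ?_ _
    refine ((((a1.fun_mul ((b2.fun_mul c3).fun_sub (c2.fun_mul b3))).fun_sub
      (a2.fun_mul ((b1.fun_mul c3).fun_sub (c1.fun_mul b3)))).fun_add
      (a3.fun_mul ((b1.fun_mul c2).fun_sub (c1.fun_mul b2))))).congr_deriv ?_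
    rw [← det3_flow a b c (coef lam (2 * g + 1)) d _ _ _ _ hda hdb hdc]
    simp only [zero_smul, add_zero, det3]
    ring

/-- The differential equations in terms of generating functions, at generic arguments. -/
theorem generating_equation (h : JacobiInversion lam U x y) (hU : IsOpen U)
    (hζ : ∀ j, AnalyticOnNhd ℂ (ζ j) U)
    (hd : ∀ u ∈ U, ∀ j, fderiv ℂ (fun v => -ζ j v) u = zetaForm lam x y j u)
    (hu : u ∈ U) {a b c d H : ℂ} (ha : ∀ i, a ≠ x i u) (hb : ∀ i, b ≠ x i u) (hc : ∀ i, c ≠ x i u)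
    (hd' : ∀ i, d ≠ x i u) (hab : a ≠ b) (hac : a ≠ c) (had : a ≠ d) (hbc : b ≠ c) (hbd : b ≠ d)
    (hcd : c ≠ d)
    (hH : H = (a ^ 2 * b ^ 2 + a ^ 2 * c ^ 2 + a ^ 2 * d ^ 2 + b ^ 2 * c ^ 2 + b ^ 2 * d ^ 2
      + c ^ 2 * d ^ 2) - (a ^ 2 * b * c + a ^ 2 * b * d + a ^ 2 * c * d + b ^ 2 * a * c
      + b ^ 2 * a * d + b ^ 2 * c * d + c ^ 2 * a * b + c ^ 2 * a * d + c ^ 2 * b * d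
      + d ^ 2 * a * b + d ^ 2 * a * c + d ^ 2 * b * c) + 6 * (a * b * c * d)) :
    (a - b) * (a - c) * (a - d) * (b - c) * (b - d) * (c - d) *
      (fderiv ℂ (fun v => fderiv ℂ (gen ζ a b) v (dir g c)) u (dir g d)
        - 2 * (gen ζ a b u * gen ζ c d u + gen ζ a c u * gen ζ b d u
          + gen ζ a d u * gen ζ b c u)) =
      -2 * H * ((a - b) * (c - d) * gen ζ a b u * gen ζ c d u
          - (a - c) * (b - d) * gen ζ a c u * gen ζ b d u
          + (a - d) * (b - c) * gen ζ a d u * gen ζ b c u)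
      + 1 / 2 * ((a - b) ^ 3 * (c - d) * gen ζ a b u * polar g (coef lam) c d
          - (a - c) ^ 3 * (b - d) * gen ζ a c u * polar g (coef lam) b d
          + (a - d) ^ 3 * (b - c) * gen ζ a d u * polar g (coef lam) b c
          + (a - b) * (c - d) ^ 3 * gen ζ c d u * polar g (coef lam) a b
          - (a - c) * (b - d) ^ 3 * gen ζ b d u * polar g (coef lam) a c
          + (a - d) * (b - c) ^ 3 * gen ζ b c u * polar g (coef lam) a d)
      - 1 / 8 * ((a - b) * (c - d) * polar g (coef lam) a b * polar g (coef lam) c d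
          - (a - c) * (b - d) * polar g (coef lam) a c * polar g (coef lam) b d
          + (a - d) * (b - c) * polar g (coef lam) a d * polar g (coef lam) b c) := by
  have s := fun {p q : ℂ} (hpq : p ≠ q) => sub_ne_zero.2 hpq
  rw [h.fderiv_fderiv_gen hU hζ hd hu ha hb hc hd' (s hab) (s hac.symm) (s hbc.symm) (s had.symm)
    (s hbd.symm) (s hcd.symm)]
  have key := quartic_identity a b c d _ _ _ _ _ _ _ _ _ _ _ _ H _ _ _ _ _ _ (s hab) (s hac)
    (s had) (s hbc) (s hbd) (s hcd) hH (h.gen_eq hU hd hu ha hb hab) (h.gen_eq hU hd hu ha hc hac)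
    (h.gen_eq hU hd hu ha hd' had) (h.gen_eq hU hd hu hb hc hbc) (h.gen_eq hU hd hu hb hd' hbd)
    (h.gen_eq hU hd hu hc hd' hcd)
  rw [← key]
  simp only [bil_comm (triple lam x y d u), bil_comm (triple lam x y c u) (triple lam x y a u),
    bil_comm (triple lam x y c u) (triple lam x y b u),
    bil_comm (triple lam x y b u) (triple lam x y a u)]

end JacobiInversion

end

end

end HyperWp

/-! ### Combinatorics of index quadruples and Pfaffians. -/

namespace HyperWp

noncomputable section

/-! ### Sums over quadruples -/

theorem sum_piFinset_four {M : Type*} [AddCommMonoid M] (s : Finset ℕ) (h : (Fin 4 → ℕ) → M) :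
    ∑ a ∈ Fintype.piFinset fun _ : Fin 4 => s, h a =
      ∑ p ∈ s, ∑ q ∈ s, ∑ r ∈ s, ∑ t ∈ s, h ![p, q, r, t] := by
  simp only [Finset.sum_sigma']
  refine Finset.sum_nbij' (fun a => ⟨a 0, a 1, a 2, a 3⟩) (fun b => ![b.1, b.2.1, b.2.2.1, b.2.2.2])
    ?_ ?_ ?_ ?_ ?_
  · intro a ha
    rw [Fintype.mem_piFinset] at ha
    simp [ha]
  · rintro ⟨p, q, r, t⟩ hb
    simp only [Finset.mem_sigma] at hb
    rw [Fintype.mem_piFinset]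
    intro i
    fin_cases i <;> simp [hb]
  · intro a _
    ext i
    fin_cases i <;> rfl
  · rintro ⟨p, q, r, t⟩ _
    rfl
  · intro a _
    congr 1
    ext i
    fin_cases i <;> rfl

/-- The rearrangements of a quadruple. -/
def orbit (a : Fin 4 → ℕ) : Finset (Fin 4 → ℕ) :=
  Finset.univ.image fun π : Equiv.Perm (Fin 4) => a ∘ π

theorem mem_orbit {a b : Fin 4 → ℕ} : b ∈ orbit a ↔ ∃ π : Equiv.Perm (Fin 4), a ∘ π = b := by
  simp [orbit]

theorem antitone_iff_four {a : Fin 4 → ℕ} : Antitone a ↔ a 1 ≤ a 0 ∧ a 2 ≤ a 1 ∧ a 3 ≤ a 2 := by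
  rw [Fin.antitone_iff_succ_le]
  simp [Fin.forall_fin_succ]

theorem strictAnti_iff_four {a : Fin 4 → ℕ} : StrictAnti a ↔ a 1 < a 0 ∧ a 2 < a 1 ∧ a 3 < a 2 := by
  rw [Fin.strictAnti_iff_succ_lt]
  simp [Fin.forall_fin_succ]

/-- Every quadruple has exactly one weakly decreasing rearrangement, so the orbits of the decreasing
quadruples partition the cube. -/
theorem sum_antitone_orbit {M : Type*} [AddCommMonoid M] (s : Finset ℕ) (h : (Fin 4 → ℕ) → M) :
    ∑ a ∈ (Fintype.piFinset fun _ : Fin 4 => s).filter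
        fun a => a 1 ≤ a 0 ∧ a 2 ≤ a 1 ∧ a 3 ≤ a 2, ∑ b ∈ orbit a, h b =
      ∑ b ∈ Fintype.piFinset fun _ : Fin 4 => s, h b := by
  rw [← Finset.sum_biUnion]
  · refine Finset.sum_congr ?_ fun _ _ => rfl
    ext b
    simp only [Finset.mem_biUnion, Finset.mem_filter, Fintype.mem_piFinset, mem_orbit,
      ← antitone_iff_four]
    constructor
    · rintro ⟨a, ⟨ha, -⟩, π, rfl⟩ i
      exact ha _
    · intro hb
      -- Sorting in the dual order gives a decreasing arrangement.
      set τ := Tuple.sort (OrderDual.toDual ∘ b) with hτ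
      refine ⟨b ∘ τ, ⟨fun i => hb _, ?_⟩, τ⁻¹, ?_⟩
      · exact Tuple.monotone_sort (OrderDual.toDual ∘ b)
      · ext i
        simp
  · intro a ha a' ha' hne
    simp only [Finset.coe_filter, Set.mem_ofPred_eq, ← antitone_iff_four] at ha ha'
    refine Finset.disjoint_left.2 fun b hb hb' => hne ?_
    obtain ⟨π, rfl⟩ := mem_orbit.1 hb
    obtain ⟨τ, hτ⟩ := mem_orbit.1 hb'
    have e : a' = a ∘ (π * τ⁻¹ : Equiv.Perm (Fin 4)) := by
      ext i
      have := congrFun hτ (τ⁻¹ i)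
      simpa using this
    have h1 : Monotone ((OrderDual.toDual ∘ a) ∘ (1 : Equiv.Perm (Fin 4))) := ha.2
    have h2 : Monotone ((OrderDual.toDual ∘ a) ∘ (π * τ⁻¹ : Equiv.Perm (Fin 4))) := by
      have := ha'.2
      rw [e] at this
      exact this
    have h3 := Tuple.unique_monotone h1 h2
    rw [e]
    exact h3

/-- A strictly decreasing quadruple has 24 distinct rearrangements, so its orbit may be summed over
permutations; the other orbits contain only quadruples with a repeated entry. -/
theorem sum_strictAnti_perm {M : Type*} [AddCommMonoid M] (s : Finset ℕ) (h : (Fin 4 → ℕ) → M)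
    (h0 : ∀ b, ¬ Function.Injective b → h b = 0) :
    ∑ a ∈ (Fintype.piFinset fun _ : Fin 4 => s).filter
        fun a => a 1 < a 0 ∧ a 2 < a 1 ∧ a 3 < a 2, ∑ π : Equiv.Perm (Fin 4), h (a ∘ π) =
      ∑ b ∈ Fintype.piFinset fun _ : Fin 4 => s, h b := by
  rw [← sum_antitone_orbit]
  have hsub : (Fintype.piFinset fun _ : Fin 4 => s).filter
      (fun a => a 1 < a 0 ∧ a 2 < a 1 ∧ a 3 < a 2) ⊆ (Fintype.piFinset fun _ : Fin 4 => s).filter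
      fun a => a 1 ≤ a 0 ∧ a 2 ≤ a 1 ∧ a 3 ≤ a 2 :=
    Finset.monotone_filter_right _ fun a _ ha => ⟨ha.1.le, ha.2.1.le, ha.2.2.le⟩
  rw [← Finset.sum_subset hsub]
  · refine Finset.sum_congr rfl fun a ha => ?_
    rw [Finset.mem_filter, ← strictAnti_iff_four] at ha
    rw [orbit, Finset.sum_image]
    intro π _ τ _ hπτ
    ext i
    have := ha.2.injective (congrFun hπτ i)
    rw [this]
  · intro a ha hna
    rw [Finset.mem_filter, ← antitone_iff_four] at ha
    have hinj : ¬ Function.Injective a := by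
      intro hi
      refine hna (Finset.mem_filter.2 ⟨ha.1, strictAnti_iff_four.1 ?_⟩)
      exact ha.2.strictAnti_of_injective hi
    refine Finset.sum_eq_zero fun b hb => h0 b fun hb' => hinj ?_
    obtain ⟨π, rfl⟩ := mem_orbit.1 hb
    have := hb'.comp (π⁻¹).injective
    convert this
    ext i
    simp

/-- Induction along the adjacent transpositions of four letters. -/
theorem perm_four_induction {P : Equiv.Perm (Fin 4) → Prop} (one : P 1)
    (mul : ∀ π τ, P π → P τ → P (π * τ)) (h01 : P (Equiv.swap 0 1)) (h12 : P (Equiv.swap 1 2))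
    (h23 : P (Equiv.swap 2 3)) (π : Equiv.Perm (Fin 4)) : P π := by
  have hπ : π ∈ Submonoid.closure
      (Set.range fun i : Fin 3 => Equiv.swap i.castSucc i.succ) := by
    rw [Equiv.Perm.mclosure_swap_castSucc_succ]
    exact Submonoid.mem_top π
  induction hπ using Submonoid.closure_induction with
  | mem τ hτ =>
    obtain ⟨i, rfl⟩ := hτ
    fin_cases i
    · exact h01
    · exact h12
    · exact h23
  | one => exact one
  | mul π τ _ _ h1 h2 => exact mul π τ h1 h2

/-- Summing over the smallest index first, each summation is one use of the hockey-stick identity.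
-/
theorem card_weakQuads (g : ℕ) : (weakQuads g).card = (g + 3).choose 4 := by
  have hf : ∀ (c : ℕ → ℕ) (p : ℕ), p ∈ Finset.Icc 1 g →
      (∑ q ∈ Finset.Icc 1 g, if q ≤ p then c q else 0) = ∑ q ∈ Finset.Icc 1 p, c q := by
    intro c p hp
    rw [← Finset.sum_filter]
    refine Finset.sum_congr ?_ fun _ _ => rfl
    ext q
    simp only [Finset.mem_filter, Finset.mem_Icc] at hp ⊢
    omega
  have hockey : ∀ k p : ℕ, ∑ q ∈ Finset.Icc 1 p, (q + k).choose (k + 1) =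
      (p + k + 1).choose (k + 2) := by
    intro k p
    induction p with
    | zero => simp
    | succ p ih =>
      rw [Finset.sum_Icc_succ_top (by omega), ih, show p + 1 + k + 1 = p + k + 1 + 1 by ring,
        Nat.choose_succ_succ (p + k + 1) (k + 1), show p + 1 + k = p + k + 1 by ring, add_comm]
  rw [weakQuads, Finset.card_filter, sum_piFinset_four]
  have e : ∀ p q r t : ℕ, (if (![p, q, r, t] : Fin 4 → ℕ) 1 ≤ (![p, q, r, t] : Fin 4 → ℕ) 0 ∧
      (![p, q, r, t] : Fin 4 → ℕ) 2 ≤ (![p, q, r, t] : Fin 4 → ℕ) 1 ∧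
      (![p, q, r, t] : Fin 4 → ℕ) 3 ≤ (![p, q, r, t] : Fin 4 → ℕ) 2 then 1 else 0) =
      if q ≤ p then if r ≤ q then if t ≤ r then 1 else 0 else 0 else 0 := by
    intro p q r t
    by_cases h1 : q ≤ p <;> by_cases h2 : r ≤ q <;> by_cases h3 : t ≤ r <;> simp [h1, h2, h3]
  simp only [e, Finset.sum_ite_irrel, Finset.sum_const_zero]
  calc _ = ∑ p ∈ Finset.Icc 1 g, ∑ q ∈ Finset.Icc 1 g, if q ≤ p then
        ∑ r ∈ Finset.Icc 1 g, if r ≤ q then (r + 0).choose (0 + 1) else 0 else 0 := by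
        refine Finset.sum_congr rfl fun p _ => Finset.sum_congr rfl fun q _ => ?_
        congr 1
        refine Finset.sum_congr rfl fun r hr => ?_
        rw [hf _ r hr]
        simp
    _ = ∑ p ∈ Finset.Icc 1 g, ∑ q ∈ Finset.Icc 1 g, if q ≤ p then
        (q + 1).choose (1 + 1) else 0 := by
        refine Finset.sum_congr rfl fun p _ => Finset.sum_congr rfl fun q hq => ?_
        rw [hf _ q hq, hockey]
    _ = ∑ p ∈ Finset.Icc 1 g, (p + 2).choose (2 + 1) := by
        refine Finset.sum_congr rfl fun p hp => ?_
        rw [hf _ p hp, hockey]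
    _ = _ := hockey 2 g

/-! ### Polarised Pfaffians -/

/-- The polarised Pfaffian of two skew-symmetric forms. -/
def pf (A B : ℕ → ℕ → ℂ) (a : Fin 4 → ℕ) : ℂ :=
  A (a 0) (a 1) * B (a 2) (a 3) - A (a 0) (a 2) * B (a 1) (a 3) + A (a 0) (a 3) * B (a 1) (a 2)
    + B (a 0) (a 1) * A (a 2) (a 3) - B (a 0) (a 2) * A (a 1) (a 3) + B (a 0) (a 3) * A (a 1) (a 2)

/-- Adjacent transpositions generate the group; each reverses one pair and exchanges the other two
matchings. -/
theorem pf_perm {A B : ℕ → ℕ → ℂ} (hA : ∀ p q, A q p = -A p q) (hB : ∀ p q, B q p = -B p q)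
    (π : Equiv.Perm (Fin 4)) (a : Fin 4 → ℕ) :
    pf A B (a ∘ π) = (Equiv.Perm.sign π : ℤ) * pf A B a := by
  induction π using perm_four_induction generalizing a with
  | one => simp
  | mul π τ h1 h2 =>
    rw [Equiv.Perm.coe_mul, ← Function.comp_assoc, h2, h1, Equiv.Perm.sign_mul]
    push_cast
    ring
  | h01 =>
    rw [Equiv.Perm.sign_swap (by decide)]
    simp only [pf, Function.comp, Equiv.swap_apply_left, Equiv.swap_apply_right,
      Equiv.swap_apply_of_ne_of_ne (show (2 : Fin 4) ≠ 0 by decide) (show (2 : Fin 4) ≠ 1 by decide),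
      Equiv.swap_apply_of_ne_of_ne (show (3 : Fin 4) ≠ 0 by decide) (show (3 : Fin 4) ≠ 1 by decide)]
    rw [hA (a 0) (a 1), hB (a 0) (a 1)]
    push_cast
    ring
  | h12 =>
    rw [Equiv.Perm.sign_swap (by decide)]
    simp only [pf, Function.comp, Equiv.swap_apply_left, Equiv.swap_apply_right,
      Equiv.swap_apply_of_ne_of_ne (show (0 : Fin 4) ≠ 1 by decide) (show (0 : Fin 4) ≠ 2 by decide),
      Equiv.swap_apply_of_ne_of_ne (show (3 : Fin 4) ≠ 1 by decide) (show (3 : Fin 4) ≠ 2 by decide)]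
    rw [hA (a 1) (a 2), hB (a 1) (a 2)]
    push_cast
    ring
  | h23 =>
    rw [Equiv.Perm.sign_swap (by decide)]
    simp only [pf, Function.comp, Equiv.swap_apply_left, Equiv.swap_apply_right,
      Equiv.swap_apply_of_ne_of_ne (show (0 : Fin 4) ≠ 2 by decide) (show (0 : Fin 4) ≠ 3 by decide),
      Equiv.swap_apply_of_ne_of_ne (show (1 : Fin 4) ≠ 2 by decide) (show (1 : Fin 4) ≠ 3 by decide)]
    rw [hA (a 2) (a 3), hB (a 2) (a 3)]
    push_cast
    ring

theorem pf_eq_zero {A B : ℕ → ℕ → ℂ} (hA : ∀ p q, A q p = -A p q) (hB : ∀ p q, B q p = -B p q)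
    (a : Fin 4 → ℕ) (ha : ¬ Function.Injective a) : pf A B a = 0 := by
  obtain ⟨i, j, hij, hne⟩ := Function.not_injective_iff.1 ha
  have h := pf_perm hA hB (Equiv.swap i j) a
  have e : a ∘ Equiv.swap i j = a := by
    ext k
    simp only [Function.comp, Equiv.swap_apply_def]
    split_ifs with h1 h2
    · rw [h1, hij]
    · rw [h2, hij]
    · rfl
  rw [e, Equiv.Perm.sign_swap hne] at h
  push_cast at h
  linear_combination h / 2

/-- The generating polynomial of a bilinear form on `{0, …, n - 1}`. -/
def formGen (n : ℕ) (A : ℕ → ℕ → ℂ) (x y : ℂ) : ℂ :=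
  ∑ p ∈ Finset.range n, ∑ q ∈ Finset.range n, A p q * (x ^ p * y ^ q)

theorem sum_mul_four (s : Finset ℕ) (A B : ℕ → ℕ → ℂ) :
    ∑ p ∈ s, ∑ q ∈ s, ∑ r ∈ s, ∑ t ∈ s, A p q * B r t =
      (∑ p ∈ s, ∑ q ∈ s, A p q) * ∑ r ∈ s, ∑ t ∈ s, B r t := by
  rw [Finset.sum_mul]
  refine Finset.sum_congr rfl fun p _ => ?_
  rw [Finset.sum_mul]
  simp only [Finset.mul_sum]

theorem sum_pf (n : ℕ) (A B : ℕ → ℕ → ℂ) (v : Fin 4 → ℂ) :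
    ∑ b ∈ Fintype.piFinset fun _ : Fin 4 => Finset.range n, pf A B b * ∏ i, v i ^ b i =
      formGen n A (v 0) (v 1) * formGen n B (v 2) (v 3)
        - formGen n A (v 0) (v 2) * formGen n B (v 1) (v 3)
        + formGen n A (v 0) (v 3) * formGen n B (v 1) (v 2)
        + formGen n B (v 0) (v 1) * formGen n A (v 2) (v 3)
        - formGen n B (v 0) (v 2) * formGen n A (v 1) (v 3)
        + formGen n B (v 0) (v 3) * formGen n A (v 1) (v 2) := by
  have h1 : ∀ C D : ℕ → ℕ → ℂ, ∑ b ∈ Fintype.piFinset fun _ : Fin 4 => Finset.range n,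
      C (b 0) (b 1) * D (b 2) (b 3) * ∏ i, v i ^ b i =
        formGen n C (v 0) (v 1) * formGen n D (v 2) (v 3) := by
    intro C D
    rw [sum_piFinset_four, formGen, formGen, ← sum_mul_four]
    refine Finset.sum_congr rfl fun p _ => Finset.sum_congr rfl fun q _ =>
      Finset.sum_congr rfl fun r _ => Finset.sum_congr rfl fun t _ => ?_
    simp [Fin.prod_univ_four]
    ring
  have h2 : ∀ C D : ℕ → ℕ → ℂ, ∑ b ∈ Fintype.piFinset fun _ : Fin 4 => Finset.range n,
      C (b 0) (b 2) * D (b 1) (b 3) * ∏ i, v i ^ b i =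
        formGen n C (v 0) (v 2) * formGen n D (v 1) (v 3) := by
    intro C D
    rw [sum_piFinset_four, formGen, formGen, ← sum_mul_four]
    refine Finset.sum_congr rfl fun p _ => ?_
    rw [Finset.sum_comm]
    refine Finset.sum_congr rfl fun q _ =>
      Finset.sum_congr rfl fun r _ => Finset.sum_congr rfl fun t _ => ?_
    simp [Fin.prod_univ_four]
    ring
  have h3 : ∀ C D : ℕ → ℕ → ℂ, ∑ b ∈ Fintype.piFinset fun _ : Fin 4 => Finset.range n,
      C (b 0) (b 3) * D (b 1) (b 2) * ∏ i, v i ^ b i =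
        formGen n C (v 0) (v 3) * formGen n D (v 1) (v 2) := by
    intro C D
    rw [sum_piFinset_four, formGen, formGen, ← sum_mul_four]
    refine Finset.sum_congr rfl fun p _ => ?_
    rw [Finset.sum_congr rfl fun q _ => Finset.sum_comm, Finset.sum_comm]
    refine Finset.sum_congr rfl fun q _ =>
      Finset.sum_congr rfl fun r _ => Finset.sum_congr rfl fun t _ => ?_
    simp [Fin.prod_univ_four]
    ring
  simp only [pf, add_mul, sub_mul, Finset.sum_add_distrib, Finset.sum_sub_distrib, h1, h2, h3]

open MvPolynomial in
theorem eval_altDet (a : Fin 4 → ℕ) (v : Fin 4 → ℂ) :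
    eval v (altDet a) = ∑ π : Equiv.Perm (Fin 4),
      ((Equiv.Perm.sign π : ℤ) : ℂ) * ∏ i, v i ^ (a ∘ π) i := by
  rw [altDet, RingHom.map_det, Matrix.det_apply']
  refine Finset.sum_congr rfl fun π _ => ?_
  simp

open MvPolynomial in
/-- The generating function of a polarised Pfaffian. -/
theorem sum_pf_altDet (g : ℕ) {A B : ℕ → ℕ → ℂ} (hA : ∀ p q, A q p = -A p q)
    (hB : ∀ p q, B q p = -B p q) (v : Fin 4 → ℂ) :
    ∑ a ∈ strictQuads g, pf A B a * eval v (altDet a) =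
      formGen (g + 3) A (v 0) (v 1) * formGen (g + 3) B (v 2) (v 3)
        - formGen (g + 3) A (v 0) (v 2) * formGen (g + 3) B (v 1) (v 3)
        + formGen (g + 3) A (v 0) (v 3) * formGen (g + 3) B (v 1) (v 2)
        + formGen (g + 3) B (v 0) (v 1) * formGen (g + 3) A (v 2) (v 3)
        - formGen (g + 3) B (v 0) (v 2) * formGen (g + 3) A (v 1) (v 3)
        + formGen (g + 3) B (v 0) (v 3) * formGen (g + 3) A (v 1) (v 2) := by
  -- The signs in the expansion of the determinant are those of `pf_perm`, so the sum over
  -- decreasing quadruples unfolds to all quadruples, where the three matchings factor.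
  rw [← sum_pf, ← sum_strictAnti_perm (Finset.range (g + 3))
    (fun b => pf A B b * ∏ i, v i ^ b i) fun b hb => by rw [pf_eq_zero hA hB b hb, zero_mul]]
  refine Finset.sum_congr rfl fun a _ => ?_
  rw [eval_altDet, Finset.mul_sum]
  refine Finset.sum_congr rfl fun π _ => ?_
  rw [pf_perm hA hB]
  ring

/-- Truncated subtraction of 1 is injective on the orbit because all the entries are positive. -/
theorem orbit_pred (m : Fin 4 → ℕ) (hm : ∀ i, 1 ≤ m i) {M : Type*} [AddCommMonoid M]
    (h : (Fin 4 → ℕ) → M) :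
    ∑ b ∈ Finset.univ.image (fun π : Equiv.Perm (Fin 4) => (fun i => m i - 1) ∘ π), h b =
      ∑ b ∈ orbit m, h fun i => b i - 1 := by
  have e : Finset.univ.image (fun π : Equiv.Perm (Fin 4) => (fun i => m i - 1) ∘ π) =
      (orbit m).image fun b i => b i - 1 := by
    rw [orbit, Finset.image_image]
    rfl
  rw [e, Finset.sum_image]
  intro b hb c hc hbc
  obtain ⟨π, rfl⟩ := mem_orbit.1 hb
  obtain ⟨τ, rfl⟩ := mem_orbit.1 hc
  ext i
  have := congrFun hbc i
  have h1 := hm (π i)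
  have h2 := hm (τ i)
  simp only [Function.comp] at this ⊢
  omega

open MvPolynomial in
theorem eval_symMon_pred (m : Fin 4 → ℕ) (hm : ∀ i, 1 ≤ m i) (v : Fin 4 → ℂ) :
    eval v (symMon fun i => m i - 1) = ∑ b ∈ orbit m, ∏ i, v i ^ (b i - 1) := by
  rw [← orbit_pred m hm fun b => ∏ i, v i ^ b i]
  simp [symMon]

end

end HyperWp

/-! ### Generating functions of the bracket symbols and symmetry of the ℘'s. -/

namespace HyperWp

noncomputable section

section

variable {g : ℕ} {ζ : Fin g → (Fin g → ℂ) → ℂ} {u : Fin g → ℂ}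

theorem pderivU_succ (k : Fin g) (φ : (Fin g → ℂ) → ℂ) (u : Fin g → ℂ) :
    pderivU ((k : ℕ) + 1 : ℤ) φ u = fderiv ℂ φ u (Pi.single k 1) := by
  have := k.2
  rw [pderivU, dif_pos (by omega)]
  congr 2
  ext
  simp

theorem wp_succ (j : Fin g) (k : ℤ) (u : Fin g → ℂ) :
    wp ζ ((j : ℕ) + 1 : ℤ) k u = pderivU k (fun v => -ζ j v) u := by
  have := j.2
  rw [wp, dif_pos (by omega)]
  congr
  ext
  simp

theorem wp_eq_zero_left {j : ℤ} (hj : ¬ (1 ≤ j ∧ j ≤ g)) (k : ℤ) : wp ζ j k u = 0 :=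
  dif_neg hj

theorem wp_eq_zero_right (j : ℤ) {k : ℤ} (hk : ¬ (1 ≤ k ∧ k ≤ g)) : wp ζ j k u = 0 := by
  unfold wp
  split_ifs
  · exact dif_neg hk
  · rfl

theorem fderiv_dir (φ : (Fin g → ℂ) → ℂ) (u : Fin g → ℂ) (w : ℂ) :
    fderiv ℂ φ u (dir g w) = ∑ k : Fin g, w ^ (k : ℕ) * pderivU ((k : ℕ) + 1 : ℤ) φ u := by
  have h : dir g w = ∑ k : Fin g, w ^ (k : ℕ) • (Pi.single k 1 : Fin g → ℂ) := by
    conv_lhs => rw [← Finset.univ_sum_single (dir g w)]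
    refine Finset.sum_congr rfl fun k _ => ?_
    rw [← Pi.single_smul, smul_eq_mul, mul_one]
    rfl
  rw [h, map_sum]
  simp only [map_smul, smul_eq_mul, pderivU_succ]

theorem analyticAt_pderivU {φ : (Fin g → ℂ) → ℂ} (h : AnalyticAt ℂ φ u) (k : ℤ) :
    AnalyticAt ℂ (pderivU k φ) u := by
  by_cases hk : 1 ≤ k ∧ k ≤ g
  · have e : pderivU k φ = fun u => fderiv ℂ φ u (Pi.single ⟨(k - 1).toNat, by omega⟩ 1) := by
      ext u
      exact dif_pos hk
    rw [e]
    exact analyticAt_fderiv_apply h _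
  · have e : pderivU k φ = fun _ => 0 := by
      ext u
      exact dif_neg hk
    rw [e]
    exact analyticAt_const

theorem analyticAt_wp (hζ : ∀ j, AnalyticAt ℂ (ζ j) u) (j k : ℤ) : AnalyticAt ℂ (wp ζ j k) u := by
  by_cases hj : 1 ≤ j ∧ j ≤ g
  · have e : wp ζ j k = pderivU k fun v => -ζ ⟨(j - 1).toNat, by omega⟩ v := by
      ext u
      exact dif_pos hj
    rw [e]
    exact analyticAt_pderivU (hζ _).neg k
  · have e : wp ζ j k = fun _ => 0 := by
      ext u
      exact dif_neg hj
    rw [e]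
    exact analyticAt_const

theorem gen_eq_sum (z w : ℂ) (u : Fin g → ℂ) :
    gen ζ z w u = ∑ p : Fin g × Fin g, z ^ (p.1 : ℕ) * w ^ (p.2 : ℕ) *
      wp ζ ((p.1 : ℕ) + 1 : ℤ) ((p.2 : ℕ) + 1 : ℤ) u := by
  rw [gen, Fintype.sum_prod_type]
  refine Finset.sum_congr rfl fun j _ => ?_
  rw [fderiv_dir, Finset.mul_sum]
  refine Finset.sum_congr rfl fun k _ => ?_
  rw [wp_succ]
  ring

theorem pderivU_sum {ι : Type*} (s : Finset ι) (c : ι → ℂ) {φ : ι → (Fin g → ℂ) → ℂ}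
    (h : ∀ i, DifferentiableAt ℂ (φ i) u) (k : ℤ) :
    pderivU k (fun v => ∑ i ∈ s, c i * φ i v) u = ∑ i ∈ s, c i * pderivU k (φ i) u := by
  unfold pderivU
  split_ifs
  · rw [fderiv_fun_sum fun i _ => (h i).const_mul _, sum_apply]
    refine Finset.sum_congr rfl fun i _ => ?_
    rw [fderiv_const_mul (h i)]
    rfl
  · simp

theorem pderivU_congr {φ ψ : (Fin g → ℂ) → ℂ} (h : φ =ᶠ[nhds u] ψ) (k : ℤ) :
    pderivU k φ u = pderivU k ψ u := by
  unfold pderivU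
  rw [h.fderiv_eq]

theorem pderivU_comm {φ : (Fin g → ℂ) → ℂ} (h : AnalyticAt ℂ φ u) (k l : ℤ) :
    pderivU k (pderivU l φ) u = pderivU l (pderivU k φ) u := by
  by_cases hk : 1 ≤ k ∧ k ≤ g
  · by_cases hl : 1 ≤ l ∧ l ≤ g
    · have e : ∀ (n : ℤ) (hn : 1 ≤ n ∧ n ≤ g), pderivU n φ = fun u => fderiv ℂ φ u
          (Pi.single ⟨(n - 1).toNat, by omega⟩ 1) := by
        intro n hn
        ext u
        exact dif_pos hn
      have e2 : ∀ a b : Fin g → ℂ, fderiv ℂ (fun u => fderiv ℂ φ u a) u b =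
          fderiv ℂ (fderiv ℂ φ) u b a := by
        intro a b
        rw [fderiv_clm_apply h.fderiv.differentiableAt (differentiableAt_const a)]
        simp
      rw [e l hl, e k hk, pderivU, pderivU, dif_pos hk, dif_pos hl, e2, e2]
      exact (h.contDiffAt (n := ⊤)).isSymmSndFDerivAt_of_omega _ _
    · have e : pderivU l φ = fun _ => 0 := by
        ext u
        exact dif_neg hl
      rw [e, pderivU, dif_pos hk, pderivU, dif_neg hl]
      simp
  · have e : pderivU k φ = fun _ => 0 := by
      ext u
      exact dif_neg hk
    rw [e, pderivU, dif_neg hk, pderivU]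
    split_ifs <;> simp

theorem fderiv_fderiv_gen_eq_sum (hζ : ∀ᶠ v in nhds u, ∀ j, AnalyticAt ℂ (ζ j) v) (a b c d : ℂ) :
    fderiv ℂ (fun v => fderiv ℂ (gen ζ a b) v (dir g c)) u (dir g d) =
      ∑ j : Fin g, ∑ k : Fin g, ∑ l : Fin g, ∑ m : Fin g,
        wp4 ζ ((j : ℕ) + 1 : ℤ) ((k : ℕ) + 1 : ℤ) ((l : ℕ) + 1 : ℤ) ((m : ℕ) + 1 : ℤ) u *
          (a ^ (j : ℕ) * b ^ (k : ℕ) * c ^ (l : ℕ) * d ^ (m : ℕ)) := by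
  have hg : gen ζ a b = fun v => ∑ p : Fin g × Fin g, a ^ (p.1 : ℕ) * b ^ (p.2 : ℕ) *
      wp ζ ((p.1 : ℕ) + 1 : ℤ) ((p.2 : ℕ) + 1 : ℤ) v := funext fun v => gen_eq_sum a b v
  have h1 : (fun v => fderiv ℂ (gen ζ a b) v (dir g c)) =ᶠ[nhds u] fun v =>
      ∑ q : Fin g × Fin g × Fin g, (c ^ (q.1 : ℕ) * (a ^ (q.2.1 : ℕ) * b ^ (q.2.2 : ℕ))) *
        pderivU ((q.1 : ℕ) + 1 : ℤ) (wp ζ ((q.2.1 : ℕ) + 1 : ℤ) ((q.2.2 : ℕ) + 1 : ℤ)) v := by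
    filter_upwards [hζ] with v hv
    rw [fderiv_dir, Fintype.sum_prod_type]
    refine Finset.sum_congr rfl fun l _ => ?_
    rw [hg, pderivU_sum _ _ fun p => (analyticAt_wp hv _ _).differentiableAt, Finset.mul_sum]
    exact Finset.sum_congr rfl fun p _ => by ring
  rw [h1.fderiv_eq, fderiv_dir]
  have h2 : ∀ m : Fin g, pderivU ((m : ℕ) + 1 : ℤ) (fun v =>
      ∑ q : Fin g × Fin g × Fin g, (c ^ (q.1 : ℕ) * (a ^ (q.2.1 : ℕ) * b ^ (q.2.2 : ℕ))) *
        pderivU ((q.1 : ℕ) + 1 : ℤ) (wp ζ ((q.2.1 : ℕ) + 1 : ℤ) ((q.2.2 : ℕ) + 1 : ℤ)) v) u =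
      ∑ l : Fin g, ∑ j : Fin g, ∑ k : Fin g, (c ^ (l : ℕ) * (a ^ (j : ℕ) * b ^ (k : ℕ))) *
        wp4 ζ ((j : ℕ) + 1 : ℤ) ((k : ℕ) + 1 : ℤ) ((l : ℕ) + 1 : ℤ) ((m : ℕ) + 1 : ℤ) u := by
    intro m
    rw [pderivU_sum _ _ fun q =>
      (analyticAt_pderivU (analyticAt_wp hζ.self_of_nhds _ _) _).differentiableAt]
    simp only [Fintype.sum_prod_type]
    rfl
  simp only [h2, Finset.mul_sum]
  rw [Finset.sum_comm, Finset.sum_congr rfl fun l _ => Finset.sum_comm, Finset.sum_comm]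
  refine Finset.sum_congr rfl fun j _ => ?_
  rw [Finset.sum_congr rfl fun l _ => Finset.sum_comm, Finset.sum_comm]
  refine Finset.sum_congr rfl fun k _ => Finset.sum_congr rfl fun l _ =>
    Finset.sum_congr rfl fun m _ => by ring

/-! ### Generating functions of the bracket symbols -/

/-- The convention that ℘ vanishes outside 1, …, g turns an index shift into multiplication by x^d.
The brackets need d ≤ 3, and then every exponent that occurs is at most g + 2. -/
theorem sum_range_shift {φ : ℤ → ℂ} (hφ : ∀ n, ¬ (1 ≤ n ∧ n ≤ (g : ℤ)) → φ n = 0) {d : ℕ}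
    (hd : d ≤ 3) (x : ℂ) : ∑ p ∈ Finset.range (g + 3), φ ((p : ℤ) + 1 - (d : ℤ)) * x ^ p =
      ∑ j : Fin g, φ ((j : ℕ) + 1 : ℤ) * x ^ ((j : ℕ) + d) := by
  rw [← Finset.sum_range fun j => φ ((j : ℤ) + 1) * x ^ (j + d)]
  have h1 : ∑ j ∈ Finset.range g, φ ((j : ℤ) + 1) * x ^ (j + d) =
      ∑ p ∈ Finset.Ico d (g + d), φ ((p : ℤ) + 1 - (d : ℤ)) * x ^ p := by
    rw [Finset.sum_Ico_eq_sum_range, Nat.add_sub_cancel]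
    refine Finset.sum_congr rfl fun j _ => ?_
    rw [add_comm d j]
    congr 2
    push_cast
    ring
  rw [h1]
  symm
  refine Finset.sum_subset (fun p hp => ?_) fun p hp hp' => ?_
  · rw [Finset.mem_Ico] at hp
    rw [Finset.mem_range]
    omega
  · rw [Finset.mem_Ico] at hp'
    rw [hφ _ (by omega), zero_mul]

theorem formGen_shift {d e : ℕ} (hd : d ≤ 3) (he : e ≤ 3) (x y : ℂ) :
    formGen (g + 3) (fun p q => wp ζ ((p : ℤ) + 1 - (d : ℤ)) ((q : ℤ) + 1 - (e : ℤ)) u) x y =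
      x ^ d * y ^ e * gen ζ x y u := by
  rw [gen_eq_sum, Fintype.sum_prod_type, formGen]
  have h1 : ∀ p : ℕ, ∑ q ∈ Finset.range (g + 3),
      wp ζ ((p : ℤ) + 1 - (d : ℤ)) ((q : ℤ) + 1 - (e : ℤ)) u * (x ^ p * y ^ q) =
      (∑ k : Fin g, wp ζ ((p : ℤ) + 1 - (d : ℤ)) ((k : ℕ) + 1 : ℤ) u * y ^ ((k : ℕ) + e))
        * x ^ p := by
    intro p
    rw [← sum_range_shift (φ := fun n => wp ζ ((p : ℤ) + 1 - (d : ℤ)) n u)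
      (fun n hn => wp_eq_zero_right _ hn) he, Finset.sum_mul]
    exact Finset.sum_congr rfl fun q _ => by ring
  simp only [h1]
  rw [sum_range_shift (φ := fun n => ∑ k : Fin g, wp ζ n ((k : ℕ) + 1 : ℤ) u * y ^ ((k : ℕ) + e))
    (fun n hn => Finset.sum_eq_zero fun k _ => by rw [wp_eq_zero_left hn, zero_mul]) hd,
    Finset.mul_sum]
  refine Finset.sum_congr rfl fun j _ => ?_
  rw [Finset.sum_mul, Finset.mul_sum]
  exact Finset.sum_congr rfl fun k _ => by ring

theorem formGen_add (n : ℕ) (A B : ℕ → ℕ → ℂ) (x y : ℂ) :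
    formGen n (fun p q => A p q + B p q) x y = formGen n A x y + formGen n B x y := by
  simp only [formGen, add_mul, Finset.sum_add_distrib]

theorem formGen_const_mul (n : ℕ) (c : ℂ) (A : ℕ → ℕ → ℂ) (x y : ℂ) :
    formGen n (fun p q => c * A p q) x y = c * formGen n A x y := by
  simp only [formGen, mul_assoc, Finset.mul_sum]

theorem formGen_ang2 (x y : ℂ) : formGen (g + 3) (ang2 ζ u) x y = (y - x) * gen ζ x y u := by
  have e : ang2 ζ u = fun p q : ℕ =>
      wp ζ ((p : ℤ) + 1 - ((0 : ℕ) : ℤ)) ((q : ℤ) + 1 - ((1 : ℕ) : ℤ)) u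
        + (-1) * wp ζ ((p : ℤ) + 1 - ((1 : ℕ) : ℤ)) ((q : ℤ) + 1 - ((0 : ℕ) : ℤ)) u := by
    ext p q
    simp [ang2]
    ring
  rw [e, formGen_add, formGen_const_mul, formGen_shift (by omega) (by omega),
    formGen_shift (by omega) (by omega)]
  ring

/-- The coefficients 1, -3, 3, -1 of the bracket are those of a cube, with the four shifts as its
monomials. -/
theorem formGen_dang2 (x y : ℂ) :
    formGen (g + 3) (dang2 ζ u) x y = -(x - y) ^ 3 * gen ζ x y u := by
  have e : dang2 ζ u = fun p q : ℕ =>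
      (-1) * wp ζ ((p : ℤ) + 1 - ((3 : ℕ) : ℤ)) ((q : ℤ) + 1 - ((0 : ℕ) : ℤ)) u
        + (3 * wp ζ ((p : ℤ) + 1 - ((2 : ℕ) : ℤ)) ((q : ℤ) + 1 - ((1 : ℕ) : ℤ)) u
        + ((-3) * wp ζ ((p : ℤ) + 1 - ((1 : ℕ) : ℤ)) ((q : ℤ) + 1 - ((2 : ℕ) : ℤ)) u
        + 1 * wp ζ ((p : ℤ) + 1 - ((0 : ℕ) : ℤ)) ((q : ℤ) + 1 - ((3 : ℕ) : ℤ)) u)) := by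
    ext p q
    rw [dang2, show (p : ℤ) + 1 - ((3 : ℕ) : ℤ) = p - 2 by push_cast; ring,
      show (p : ℤ) + 1 - ((2 : ℕ) : ℤ) = p - 1 by push_cast; ring,
      show (p : ℤ) + 1 - ((1 : ℕ) : ℤ) = p by push_cast; ring,
      show (p : ℤ) + 1 - ((0 : ℕ) : ℤ) = p + 1 by push_cast; ring,
      show (q : ℤ) + 1 - ((3 : ℕ) : ℤ) = q - 2 by push_cast; ring,
      show (q : ℤ) + 1 - ((2 : ℕ) : ℤ) = q - 1 by push_cast; ring,
      show (q : ℤ) + 1 - ((1 : ℕ) : ℤ) = q by push_cast; ring,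
      show (q : ℤ) + 1 - ((0 : ℕ) : ℤ) = q + 1 by push_cast; ring]
    ring
  rw [e, formGen_add, formGen_add, formGen_add]
  simp only [formGen_const_mul]
  rw [formGen_shift (by omega) (by omega), formGen_shift (by omega) (by omega),
    formGen_shift (by omega) (by omega), formGen_shift (by omega) (by omega)]
  ring

theorem formGen_cur2 (lam : Fin (2 * g + 2) → ℂ) (x y : ℂ) :
    formGen (g + 3) (cur2 lam) x y = (y - x) * polar g (coef lam) x y := by
  have e : cur2 lam = fun p q : ℕ => (if q = p + 1 then 2 * coef lam (2 * p) else 0)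
      + ((-1) * (if p = q + 1 then 2 * coef lam (2 * q) else 0)
      + ((if q = p + 2 then coef lam (2 * p + 1) else 0)
      + (-1) * (if p = q + 2 then coef lam (2 * q + 1) else 0))) := by
    ext p q
    unfold cur2
    split_ifs <;> first | omega | ring
  have h1 : ∀ (d : ℕ) (c : ℕ → ℂ), 1 ≤ d → d ≤ 2 → (∀ n, g < n → c n = 0) → ∀ x y : ℂ,
      formGen (g + 3) (fun p q => if q = p + d then c p else 0) x y =
        ∑ i ∈ Finset.range (g + 1), c i * (x ^ i * y ^ (i + d)) := by
    intro d c hd1 hd2 hc x y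
    rw [formGen]
    have : ∀ p ∈ Finset.range (g + 3), ∑ q ∈ Finset.range (g + 3),
        (if q = p + d then c p else 0) * (x ^ p * y ^ q) = c p * (x ^ p * y ^ (p + d)) := by
      intro p hp
      simp only [ite_mul, zero_mul, Finset.sum_ite_eq', Finset.mem_range]
      split_ifs with h
      · rfl
      · rw [hc p (by omega), zero_mul]
    rw [Finset.sum_congr rfl this]
    symm
    -- For p > g the coefficients λ_{2p} and λ_{2p+1} vanish, so the range shrinks to the g + 1
    -- summands of `polar`.
    refine Finset.sum_subset (Finset.range_mono (by omega)) fun p _ hp => ?_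
    rw [Finset.mem_range] at hp
    rw [hc p (by omega), zero_mul]
  have h2 : ∀ (A : ℕ → ℕ → ℂ), formGen (g + 3) (fun p q => A q p) x y = formGen (g + 3) A y x := by
    intro A
    rw [formGen, formGen, Finset.sum_comm]
    exact Finset.sum_congr rfl fun p _ => Finset.sum_congr rfl fun q _ => by ring
  have hc1 : ∀ n, g < n → 2 * coef lam (2 * n) = 0 := fun n hn => by
    rw [coef_eq_zero (by omega), mul_zero]
  have hc2 : ∀ n, g < n → coef lam (2 * n + 1) = 0 := fun n hn => coef_eq_zero (by omega)
  rw [e, formGen_add, formGen_add, formGen_add, formGen_const_mul, formGen_const_mul,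
    h2 fun p q => if q = p + 1 then 2 * coef lam (2 * p) else 0,
    h2 fun p q => if q = p + 2 then coef lam (2 * p + 1) else 0,
    h1 1 (fun p => 2 * coef lam (2 * p)) (by omega) (by omega) hc1,
    h1 1 (fun p => 2 * coef lam (2 * p)) (by omega) (by omega) hc1,
    h1 2 (fun p => coef lam (2 * p + 1)) (by omega) (by omega) hc2,
    h1 2 (fun p => coef lam (2 * p + 1)) (by omega) (by omega) hc2, polar]
  simp only [Finset.mul_sum, ← Finset.sum_add_distrib]
  exact Finset.sum_congr rfl fun i _ => by rw [mul_pow]; ring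

end

/-! ### Symmetry of the `℘` symbols -/

theorem eq_zero_of_sum_mul_pow {g : ℕ} {S : Set ℂ} (hS : S.Infinite) (c : Fin g → ℂ)
    (h : ∀ z ∈ S, ∑ j : Fin g, c j * z ^ (j : ℕ) = 0) : c = 0 := by
  have e := hS.natEmbedding
  refine Matrix.eq_zero_of_forall_index_sum_mul_pow_eq_zero
    (f := fun i : Fin g => ((e (i : ℕ) : S) : ℂ)) ?_ ?_
  · intro i j hij
    exact Fin.ext (e.injective (Subtype.ext hij))
  · intro i
    exact h _ (e (i : ℕ)).2

namespace JacobiInversion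

variable {g : ℕ} {lam : Fin (2 * g + 2) → ℂ} {U : Set (Fin g → ℂ)}
  {x y : Fin g → (Fin g → ℂ) → ℂ} {u : Fin g → ℂ} {ζ : Fin g → (Fin g → ℂ) → ℂ}

/-- The closed formula `gen_eq` is symmetric in z and w; comparing coefficients in w and then in z
gives the symmetry of ℘_{jk}. -/
theorem wp_comm (h : JacobiInversion lam U x y) (hU : IsOpen U)
    (hd : ∀ u ∈ U, ∀ j, fderiv ℂ (fun v => -ζ j v) u = zetaForm lam x y j u)
    (hu : u ∈ U) (j k : ℤ) : wp ζ j k u = wp ζ k j u := by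
  by_cases hj : 1 ≤ j ∧ j ≤ g
  swap
  · rw [wp_eq_zero_left hj, wp_eq_zero_right _ hj]
  by_cases hk : 1 ≤ k ∧ k ≤ g
  swap
  · rw [wp_eq_zero_left hk, wp_eq_zero_right _ hk]
  set D : Fin g → Fin g → ℂ := fun j k => wp ζ ((j : ℕ) + 1 : ℤ) ((k : ℕ) + 1 : ℤ) u
    - wp ζ ((k : ℕ) + 1 : ℤ) ((j : ℕ) + 1 : ℤ) u with hD
  have hpol : ∀ z w : ℂ, polar g (coef lam) z w = polar g (coef lam) w z := fun z w =>
    Finset.sum_congr rfl fun i _ => by rw [mul_comm z w, add_comm z w]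
  -- `gen_eq` excludes the nodes and the diagonal, so w also has to avoid z; infinitely many values
  -- remain.
  have key : ∀ z ∈ (Set.range fun i => x i u)ᶜ, ∀ w ∈ (insert z (Set.range fun i => x i u))ᶜ,
      ∑ k : Fin g, (∑ j : Fin g, D j k * z ^ (j : ℕ)) * w ^ (k : ℕ) = 0 := by
    intro z hz w hw
    have hz' : ∀ i, z ≠ x i u := fun i hi => hz ⟨i, hi.symm⟩
    have hw' : ∀ i, w ≠ x i u := fun i hi => hw (Or.inr ⟨i, hi.symm⟩)
    have hzw : z ≠ w := fun hi => hw (Or.inl hi.symm)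
    have e1 := h.gen_eq hU hd hu hz' hw' hzw
    have e2 := h.gen_eq hU hd hu hw' hz' hzw.symm
    have e3 : gen ζ z w u = gen ζ w z u := by
      rw [e1, e2, hpol, bil_comm, ← neg_sub w z, neg_sq]
    rw [gen_eq_sum, gen_eq_sum, Fintype.sum_prod_type, Fintype.sum_prod_type, Finset.sum_comm,
      ← sub_eq_zero, ← Finset.sum_sub_distrib] at e3
    rw [← e3]
    refine Finset.sum_congr rfl fun k _ => ?_
    rw [← Finset.sum_sub_distrib, Finset.sum_mul]
    exact Finset.sum_congr rfl fun j _ => by rw [hD]; ring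
  have hfin := Set.finite_range fun i => x i u
  have h1 : ∀ z ∈ (Set.range fun i => x i u)ᶜ, ∀ k : Fin g, ∑ j : Fin g, D j k * z ^ (j : ℕ) = 0 :=
    fun z hz => congrFun (eq_zero_of_sum_mul_pow (hfin.insert z).infinite_compl _ (key z hz))
  have h2 : ∀ j k : Fin g, D j k = 0 := fun j k =>
    congrFun (eq_zero_of_sum_mul_pow hfin.infinite_compl (fun j => D j k) fun z hz => h1 z hz k) j
  have h3 := h2 ⟨(j - 1).toNat, by omega⟩ ⟨(k - 1).toNat, by omega⟩
  rw [hD, sub_eq_zero] at h3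
  have ej : (((j - 1).toNat : ℕ) : ℤ) + 1 = j := by omega
  have ek : (((k - 1).toNat : ℕ) : ℤ) + 1 = k := by omega
  simp only [ej, ek] at h3
  exact h3

theorem wp4_comm₀₁ (h : JacobiInversion lam U x y) (hU : IsOpen U)
    (hd : ∀ u ∈ U, ∀ j, fderiv ℂ (fun v => -ζ j v) u = zetaForm lam x y j u)
    (hu : u ∈ U) (j k l m : ℤ) : wp4 ζ j k l m u = wp4 ζ k j l m u := by
  refine pderivU_congr ?_ m
  filter_upwards [hU.mem_nhds hu] with v hv
  refine pderivU_congr ?_ l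
  filter_upwards [hU.mem_nhds hv] with v' hv'
  exact h.wp_comm hU hd hv' j k

end JacobiInversion

section

variable {g : ℕ} {U : Set (Fin g → ℂ)} {u : Fin g → ℂ} {ζ : Fin g → (Fin g → ℂ) → ℂ}

theorem wp4_comm₁₂ (hU : IsOpen U) (hζ : ∀ j, AnalyticOnNhd ℂ (ζ j) U)
    (hu : u ∈ U) (j k l m : ℤ) : wp4 ζ j k l m u = wp4 ζ j l k m u := by
  refine pderivU_congr ?_ m
  filter_upwards [hU.mem_nhds hu] with v hv
  by_cases hj : 1 ≤ j ∧ j ≤ g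
  · have e : ∀ k, wp ζ j k = pderivU k fun v => -ζ ⟨(j - 1).toNat, by omega⟩ v := by
      intro k
      ext u
      exact dif_pos hj
    rw [e, e]
    exact pderivU_comm (hζ _ v hv).neg l k
  · have e : ∀ k, wp ζ j k = fun _ => 0 := by
      intro k
      ext u
      exact dif_neg hj
    rw [e, e]
    simp [pderivU]

theorem wp4_comm₂₃ (hζ : ∀ j, AnalyticOnNhd ℂ (ζ j) U)
    (hu : u ∈ U) (j k l m : ℤ) : wp4 ζ j k l m u = wp4 ζ j k m l u :=
  pderivU_comm (analyticAt_wp (fun j => hζ j u hu) j k) m l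

end

/-- Of the three adjacent transpositions, the first rests on `wp_comm`, the other two on the
equality of mixed partial derivatives. -/
theorem JacobiInversion.sqBr_perm {g : ℕ} {lam : Fin (2 * g + 2) → ℂ} {U : Set (Fin g → ℂ)}
    {x y : Fin g → (Fin g → ℂ) → ℂ} {u : Fin g → ℂ} {ζ : Fin g → (Fin g → ℂ) → ℂ}
    (h : JacobiInversion lam U x y) (hU : IsOpen U) (hζ : ∀ j, AnalyticOnNhd ℂ (ζ j) U)
    (hd : ∀ u ∈ U, ∀ j, fderiv ℂ (fun v => -ζ j v) u = zetaForm lam x y j u)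
    (hu : u ∈ U) (π : Equiv.Perm (Fin 4)) (m : Fin 4 → ℕ) : sqBr ζ (m ∘ π) u = sqBr ζ m u := by
  have hc := fun j k => h.wp_comm hU hd hu j k
  induction π using perm_four_induction generalizing m with
  | one => rfl
  | mul π τ h1 h2 => rw [Equiv.Perm.coe_mul, ← Function.comp_assoc, h2, h1]
  | h01 =>
    simp only [sqBr, Function.comp, Equiv.swap_apply_left, Equiv.swap_apply_right,
      Equiv.swap_apply_of_ne_of_ne (show (2 : Fin 4) ≠ 0 by decide) (show (2 : Fin 4) ≠ 1 by decide),
      Equiv.swap_apply_of_ne_of_ne (show (3 : Fin 4) ≠ 0 by decide) (show (3 : Fin 4) ≠ 1 by decide)]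
    rw [h.wp4_comm₀₁ hU hd hu, hc (m 1) (m 0)]
    ring
  | h12 =>
    simp only [sqBr, Function.comp, Equiv.swap_apply_left, Equiv.swap_apply_right,
      Equiv.swap_apply_of_ne_of_ne (show (0 : Fin 4) ≠ 1 by decide) (show (0 : Fin 4) ≠ 2 by decide),
      Equiv.swap_apply_of_ne_of_ne (show (3 : Fin 4) ≠ 1 by decide) (show (3 : Fin 4) ≠ 2 by decide)]
    rw [wp4_comm₁₂ hU hζ hu, hc (m 2) (m 1)]
    ring
  | h23 =>
    simp only [sqBr, Function.comp, Equiv.swap_apply_left, Equiv.swap_apply_right,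
      Equiv.swap_apply_of_ne_of_ne (show (0 : Fin 4) ≠ 2 by decide) (show (0 : Fin 4) ≠ 3 by decide),
      Equiv.swap_apply_of_ne_of_ne (show (1 : Fin 4) ≠ 2 by decide) (show (1 : Fin 4) ≠ 3 by decide)]
    rw [wp4_comm₂₃ hζ hu, hc (m 3) (m 2)]
    ring

end

end HyperWp

/-! ### The polynomial identity, its continuation to Ω, and its coefficients. -/

namespace HyperWp

open MvPolynomial

noncomputable section

/-- The left-hand side of the system as a polynomial in four variables. -/
def lhsPoly {g : ℕ} (ζ : Fin g → (Fin g → ℂ) → ℂ) (u : Fin g → ℂ) : MvPolynomial (Fin 4) ℂ :=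
  ∑ m ∈ weakQuads g, C (sqBr ζ m u) * symMon (fun i => m i - 1)

/-- The right-hand side of the system as a polynomial in four variables. -/
def rhsPoly {g : ℕ} (lam : Fin (2 * g + 2) → ℂ) (ζ : Fin g → (Fin g → ℂ) → ℂ) (u : Fin g → ℂ) :
    MvPolynomial (Fin 4) ℂ :=
  -2 * polyH * (∑ a ∈ strictQuads g, C (ang4 ζ u a) * quotDet a)
    + C (1 / 2) * (∑ a ∈ strictQuads g, C (dang4 lam ζ u a) * quotDet a)
    - C (1 / 8) * (∑ a ∈ strictQuads g, C (cur4 lam a) * quotDet a)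

theorem symMon_2200 : symMon ![2, 2, 0, 0] = X 0 ^ 2 * X 1 ^ 2 + X 0 ^ 2 * X 2 ^ 2
    + X 0 ^ 2 * X 3 ^ 2 + X 1 ^ 2 * X 2 ^ 2 + X 1 ^ 2 * X 3 ^ 2 + X 2 ^ 2 * X 3 ^ 2 := by
  have e : Finset.univ.image (fun π : Equiv.Perm (Fin 4) => (![2, 2, 0, 0] : Fin 4 → ℕ) ∘ π) =
      {![2, 2, 0, 0], ![2, 0, 2, 0], ![2, 0, 0, 2], ![0, 2, 2, 0], ![0, 2, 0, 2],
        ![0, 0, 2, 2]} := by decide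
  rw [symMon, e]
  repeat rw [Finset.sum_insert (by decide)]
  rw [Finset.sum_singleton]
  simp [Fin.prod_univ_four]
  ring

theorem symMon_2110 : symMon ![2, 1, 1, 0] = X 0 ^ 2 * X 1 * X 2 + X 0 ^ 2 * X 1 * X 3
    + X 0 ^ 2 * X 2 * X 3 + X 1 ^ 2 * X 0 * X 2 + X 1 ^ 2 * X 0 * X 3 + X 1 ^ 2 * X 2 * X 3
    + X 2 ^ 2 * X 0 * X 1 + X 2 ^ 2 * X 0 * X 3 + X 2 ^ 2 * X 1 * X 3
    + X 3 ^ 2 * X 0 * X 1 + X 3 ^ 2 * X 0 * X 2 + X 3 ^ 2 * X 1 * X 2 := by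
  have e : Finset.univ.image (fun π : Equiv.Perm (Fin 4) => (![2, 1, 1, 0] : Fin 4 → ℕ) ∘ π) =
      {![2, 1, 1, 0], ![2, 1, 0, 1], ![2, 0, 1, 1], ![1, 2, 1, 0], ![1, 2, 0, 1], ![0, 2, 1, 1],
        ![1, 1, 2, 0], ![1, 0, 2, 1], ![0, 1, 2, 1], ![1, 1, 0, 2], ![1, 0, 1, 2],
        ![0, 1, 1, 2]} := by decide
  rw [symMon, e]
  repeat rw [Finset.sum_insert (by decide)]
  rw [Finset.sum_singleton]
  simp [Fin.prod_univ_four]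
  ring

theorem symMon_1111 : symMon ![1, 1, 1, 1] = X 0 * X 1 * X 2 * X 3 := by
  have e : Finset.univ.image (fun π : Equiv.Perm (Fin 4) => (![1, 1, 1, 1] : Fin 4 → ℕ) ∘ π) =
      {![1, 1, 1, 1]} := by decide
  rw [symMon, e, Finset.sum_singleton]
  simp [Fin.prod_univ_four]

variable {g : ℕ} {lam : Fin (2 * g + 2) → ℂ} {U : Set (Fin g → ℂ)}
  {x y : Fin g → (Fin g → ℂ) → ℂ} {u : Fin g → ℂ} {ζ : Fin g → (Fin g → ℂ) → ℂ}

theorem sum_Icc_one_eq {M : Type*} [AddCommMonoid M] (φ : ℕ → M) :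
    ∑ p ∈ Finset.Icc 1 g, φ p = ∑ j : Fin g, φ ((j : ℕ) + 1) := by
  rw [← Finset.sum_range fun j => φ (j + 1), Finset.range_eq_Ico,
    Finset.sum_Ico_add' φ 0 g 1]
  rfl

/-- By symmetry of the bracket, the distinct monomials of each (μ-1, ν-1, ρ-1, σ-1) share one
coefficient, so the sum runs over all quadruples and becomes an expression in `gen`. -/
theorem eval_lhsPoly (h : JacobiInversion lam U x y) (hU : IsOpen U)
    (hζ : ∀ j, AnalyticOnNhd ℂ (ζ j) U)
    (hd : ∀ u ∈ U, ∀ j, fderiv ℂ (fun v => -ζ j v) u = zetaForm lam x y j u)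
    (hu : u ∈ U) (v : Fin 4 → ℂ) :
    eval v (lhsPoly ζ u) =
      fderiv ℂ (fun v' => fderiv ℂ (gen ζ (v 0) (v 1)) v' (dir g (v 2))) u (dir g (v 3))
        - 2 * (gen ζ (v 0) (v 1) u * gen ζ (v 2) (v 3) u + gen ζ (v 0) (v 2) u * gen ζ (v 1) (v 3) u
          + gen ζ (v 0) (v 3) u * gen ζ (v 1) (v 2) u) := by
  have h1 : eval v (lhsPoly ζ u) = ∑ b ∈ Fintype.piFinset fun _ : Fin 4 => Finset.Icc 1 g,
      sqBr ζ b u * ∏ i, v i ^ (b i - 1) := by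
    rw [← sum_antitone_orbit, lhsPoly, map_sum, weakQuads]
    refine Finset.sum_congr rfl fun m hm => ?_
    rw [Finset.mem_filter, Fintype.mem_piFinset] at hm
    rw [map_mul, eval_C, eval_symMon_pred m (fun i => (Finset.mem_Icc.1 (hm.1 i)).1),
      Finset.mul_sum]
    refine Finset.sum_congr rfl fun b hb => ?_
    obtain ⟨π, rfl⟩ := mem_orbit.1 hb
    rw [h.sqBr_perm hU hζ hd hu]
  have h2 : ∀ z w, gen ζ z w u = ∑ j : Fin g, ∑ k : Fin g,
      wp ζ ((j : ℕ) + 1 : ℤ) ((k : ℕ) + 1 : ℤ) u * (z ^ (j : ℕ) * w ^ (k : ℕ)) := by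
    intro z w
    rw [gen_eq_sum, Fintype.sum_prod_type]
    exact Finset.sum_congr rfl fun j _ => Finset.sum_congr rfl fun k _ => by ring
  have hev : ∀ᶠ v in nhds u, ∀ j, AnalyticAt ℂ (ζ j) v := by
    filter_upwards [hU.mem_nhds hu] with v hv j
    exact hζ j v hv
  have m1 : ∀ (α β γ δ : ℂ), gen ζ α β u * gen ζ γ δ u =
      ∑ j : Fin g, ∑ k : Fin g, ∑ l : Fin g, ∑ m : Fin g,
        (wp ζ ((j : ℕ) + 1 : ℤ) ((k : ℕ) + 1 : ℤ) u * (α ^ (j : ℕ) * β ^ (k : ℕ))) *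
          (wp ζ ((l : ℕ) + 1 : ℤ) ((m : ℕ) + 1 : ℤ) u * (γ ^ (l : ℕ) * δ ^ (m : ℕ))) := by
    intro α β γ δ
    rw [h2, h2, Finset.sum_mul]
    refine Finset.sum_congr rfl fun j _ => ?_
    rw [Finset.sum_mul]
    simp only [Finset.mul_sum]
  have m2 := m1 (v 0) (v 2) (v 1) (v 3)
  -- The sums are reordered so that in all three products they follow the order of the variables.
  rw [Finset.sum_congr rfl fun j _ => Finset.sum_comm] at m2
  have m3 := m1 (v 0) (v 3) (v 1) (v 2)
  rw [Finset.sum_congr rfl fun j _ => Finset.sum_comm,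
    Finset.sum_congr rfl fun j _ => Finset.sum_congr rfl fun l _ => Finset.sum_comm] at m3
  rw [h1, sum_piFinset_four, fderiv_fderiv_gen_eq_sum hev, m1 (v 0) (v 1) (v 2) (v 3), m2, m3]
  simp only [sum_Icc_one_eq, ← Finset.sum_add_distrib, Finset.mul_sum, ← Finset.sum_sub_distrib]
  refine Finset.sum_congr rfl fun j _ => Finset.sum_congr rfl fun k _ =>
    Finset.sum_congr rfl fun l _ => Finset.sum_congr rfl fun m _ => ?_
  simp [sqBr, Fin.prod_univ_four]
  ring

/-- Multiplication by M turns the quotients |αβγδ| into determinants, to which `sum_pf_altDet`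
applies. -/
theorem eval_polyM_mul_rhsPoly (h : JacobiInversion lam U x y) (hU : IsOpen U)
    (hd : ∀ u ∈ U, ∀ j, fderiv ℂ (fun v => -ζ j v) u = zetaForm lam x y j u)
    (hu : u ∈ U) (v : Fin 4 → ℂ) :
    eval v (polyM * rhsPoly lam ζ u) =
      -2 * eval v polyH * ((v 0 - v 1) * (v 2 - v 3) * gen ζ (v 0) (v 1) u * gen ζ (v 2) (v 3) u
          - (v 0 - v 2) * (v 1 - v 3) * gen ζ (v 0) (v 2) u * gen ζ (v 1) (v 3) u
          + (v 0 - v 3) * (v 1 - v 2) * gen ζ (v 0) (v 3) u * gen ζ (v 1) (v 2) u)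
      + 1 / 2 * ((v 0 - v 1) ^ 3 * (v 2 - v 3) * gen ζ (v 0) (v 1) u
            * polar g (coef lam) (v 2) (v 3)
          - (v 0 - v 2) ^ 3 * (v 1 - v 3) * gen ζ (v 0) (v 2) u * polar g (coef lam) (v 1) (v 3)
          + (v 0 - v 3) ^ 3 * (v 1 - v 2) * gen ζ (v 0) (v 3) u * polar g (coef lam) (v 1) (v 2)
          + (v 0 - v 1) * (v 2 - v 3) ^ 3 * gen ζ (v 2) (v 3) u * polar g (coef lam) (v 0) (v 1)
          - (v 0 - v 2) * (v 1 - v 3) ^ 3 * gen ζ (v 1) (v 3) u * polar g (coef lam) (v 0) (v 2)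
          + (v 0 - v 3) * (v 1 - v 2) ^ 3 * gen ζ (v 1) (v 2) u * polar g (coef lam) (v 0) (v 3))
      - 1 / 8 * ((v 0 - v 1) * (v 2 - v 3) * polar g (coef lam) (v 0) (v 1)
            * polar g (coef lam) (v 2) (v 3)
          - (v 0 - v 2) * (v 1 - v 3) * polar g (coef lam) (v 0) (v 2)
            * polar g (coef lam) (v 1) (v 3)
          + (v 0 - v 3) * (v 1 - v 2) * polar g (coef lam) (v 0) (v 3)
            * polar g (coef lam) (v 1) (v 2)) := by
  have hc := fun j k => h.wp_comm hU hd hu j k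
  have hA : ∀ p q, ang2 ζ u q p = -ang2 ζ u p q := fun p q => by
    rw [ang2, ang2, hc ((q : ℤ) + 1) p, hc q ((p : ℤ) + 1)]
    ring
  have hB : ∀ p q, dang2 ζ u q p = -dang2 ζ u p q := fun p q => by
    rw [dang2, dang2, hc ((q : ℤ) - 2) ((p : ℤ) + 1), hc ((q : ℤ) - 1) p, hc q ((p : ℤ) - 1),
      hc ((q : ℤ) + 1) ((p : ℤ) - 2)]
    ring
  have hC : ∀ p q, cur2 lam q p = -cur2 lam p q := fun p q => by
    unfold cur2
    split_ifs <;> first | omega | simp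
  have hsum : ∀ c : (Fin 4 → ℕ) → ℂ, eval v (polyM * ∑ a ∈ strictQuads g, C (c a) * quotDet a) =
      ∑ a ∈ strictQuads g, c a * eval v (altDet a) := by
    intro c
    rw [Finset.mul_sum, map_sum]
    refine Finset.sum_congr rfl fun a _ => ?_
    rw [mul_left_comm, polyM_mul_quotDet, map_mul, eval_C]
  -- The polarised Pfaffian of a form with itself counts each matching twice.
  have e1 : ∀ a, ang4 ζ u a = 1 / 2 * pf (ang2 ζ u) (ang2 ζ u) a := fun a => by
    rw [ang4, pf]; ring
  have e2 : ∀ a, cur4 lam a = 1 / 2 * pf (cur2 lam) (cur2 lam) a := fun a => by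
    rw [cur4, pf]; ring
  have e3 : ∀ a, dang4 lam ζ u a = pf (dang2 ζ u) (cur2 lam) a := fun a => rfl
  have hr : polyM * rhsPoly lam ζ u =
      -2 * polyH * (polyM * ∑ a ∈ strictQuads g, C (ang4 ζ u a) * quotDet a)
        + C (1 / 2) * (polyM * ∑ a ∈ strictQuads g, C (dang4 lam ζ u a) * quotDet a)
        - C (1 / 8) * (polyM * ∑ a ∈ strictQuads g, C (cur4 lam a) * quotDet a) := by
    rw [rhsPoly]; ring
  rw [hr, map_sub, map_add, map_mul, map_mul _ (C _), map_mul _ (C _), hsum, hsum, hsum]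
  simp only [e1, e2, e3, mul_assoc, ← Finset.mul_sum]
  rw [sum_pf_altDet g hA hA, sum_pf_altDet g hB hC, sum_pf_altDet g hC hC]
  simp only [formGen_ang2, formGen_dang2, formGen_cur2, eval_C, map_mul, map_neg, map_ofNat]
  ring

theorem eval_polyM (v : Fin 4 → ℂ) : eval v polyM =
    (v 0 - v 1) * (v 0 - v 2) * (v 0 - v 3) * (v 1 - v 2) * (v 1 - v 3) * (v 2 - v 3) := by
  rw [polyM_eq]
  simp
  ring

/-- The system holds where Jacobi's inversion problem is solved. -/
theorem lhsPoly_eq_rhsPoly (h : JacobiInversion lam U x y) (hU : IsOpen U)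
    (hζ : ∀ j, AnalyticOnNhd ℂ (ζ j) U)
    (hd : ∀ u ∈ U, ∀ j, fderiv ℂ (fun v => -ζ j v) u = zetaForm lam x y j u)
    (hu : u ∈ U) : lhsPoly ζ u = rhsPoly lam ζ u := by
  -- After multiplication by the nonzero polynomial M·R both sides vanish where two variables
  -- coincide or one of them equals some x_r(u), so only generic points have to be checked.
  set R : MvPolynomial (Fin 4) ℂ := ∏ i : Fin 4, ∏ r : Fin g, (X i - C (x r u)) with hR
  have hR0 : R ≠ 0 := by
    refine Finset.prod_ne_zero_iff.2 fun i _ => Finset.prod_ne_zero_iff.2 fun r _ h0 => ?_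
    have := congrArg (eval fun _ => x r u + 1) h0
    simp at this
  have hM0 : polyM ≠ 0 := by
    intro h0
    have := congrArg (eval ![0, 1, 2, 3]) h0
    rw [eval_polyM] at this
    simp only [Matrix.cons_val, map_zero] at this
    norm_num at this
  refine mul_left_cancel₀ hM0 (mul_right_cancel₀ hR0 (MvPolynomial.funext fun v => ?_))
  rw [map_mul _ _ R, map_mul _ _ R]
  by_cases hRv : eval v R = 0
  · rw [hRv, mul_zero, mul_zero]
  refine congrArg (· * eval v R) ?_
  have hx : ∀ i : Fin 4, ∀ r, v i ≠ x r u := by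
    intro i r hir
    refine hRv ?_
    rw [hR, map_prod]
    refine Finset.prod_eq_zero (Finset.mem_univ i) ?_
    rw [map_prod]
    refine Finset.prod_eq_zero (Finset.mem_univ r) ?_
    simp [hir]
  have hH : eval v polyH = (v 0 ^ 2 * v 1 ^ 2 + v 0 ^ 2 * v 2 ^ 2 + v 0 ^ 2 * v 3 ^ 2
      + v 1 ^ 2 * v 2 ^ 2 + v 1 ^ 2 * v 3 ^ 2 + v 2 ^ 2 * v 3 ^ 2)
      - (v 0 ^ 2 * v 1 * v 2 + v 0 ^ 2 * v 1 * v 3 + v 0 ^ 2 * v 2 * v 3 + v 1 ^ 2 * v 0 * v 2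
      + v 1 ^ 2 * v 0 * v 3 + v 1 ^ 2 * v 2 * v 3 + v 2 ^ 2 * v 0 * v 1 + v 2 ^ 2 * v 0 * v 3
      + v 2 ^ 2 * v 1 * v 3 + v 3 ^ 2 * v 0 * v 1 + v 3 ^ 2 * v 0 * v 2 + v 3 ^ 2 * v 1 * v 2)
      + 6 * (v 0 * v 1 * v 2 * v 3) := by
    rw [polyH, symMon_2200, symMon_2110, symMon_1111]
    simp
  by_cases hM : eval v polyM = 0
  · rw [map_mul, map_mul, hM, zero_mul, zero_mul]
  · rw [eval_polyM_mul_rhsPoly h hU hd hu, map_mul, eval_lhsPoly h hU hζ hd hu]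
    rw [eval_polyM] at hM ⊢
    simp only [mul_ne_zero_iff, sub_ne_zero] at hM
    obtain ⟨⟨⟨⟨⟨h01, h02⟩, h03⟩, h12⟩, h13⟩, h23⟩ := hM
    exact h.generating_equation hU hζ hd hu (hx 0) (hx 1) (hx 2) (hx 3) h01 h02 h03 h12 h13 h23 hH

/-! ### Analytic continuation and comparison of coefficients -/

theorem analyticAt_sqBr (hζ : ∀ j, AnalyticAt ℂ (ζ j) u) (m : Fin 4 → ℕ) :
    AnalyticAt ℂ (sqBr ζ m) u := by
  have hw := analyticAt_wp hζ
  exact (analyticAt_pderivU (analyticAt_pderivU (hw _ _) _) _).fun_sub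
    (analyticAt_const.fun_mul (((hw _ _).fun_mul (hw _ _)).fun_add
      ((hw _ _).fun_mul (hw _ _)) |>.fun_add ((hw _ _).fun_mul (hw _ _))))

theorem analyticAt_ang4 (hζ : ∀ j, AnalyticAt ℂ (ζ j) u) (a : Fin 4 → ℕ) :
    AnalyticAt ℂ (fun u => ang4 ζ u a) u := by
  have hw := analyticAt_wp hζ
  have h2 : ∀ p q, AnalyticAt ℂ (fun u => ang2 ζ u p q) u := fun p q =>
    (hw _ _).fun_sub (hw _ _)
  exact (((h2 _ _).fun_mul (h2 _ _)).fun_sub ((h2 _ _).fun_mul (h2 _ _))).fun_add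
    ((h2 _ _).fun_mul (h2 _ _))

theorem analyticAt_dang4 (hζ : ∀ j, AnalyticAt ℂ (ζ j) u) (a : Fin 4 → ℕ) :
    AnalyticAt ℂ (fun u => dang4 lam ζ u a) u := by
  have hw := analyticAt_wp hζ
  have h2 : ∀ p q, AnalyticAt ℂ (fun u => dang2 ζ u p q) u := fun p q =>
    ((((hw _ _).fun_sub (analyticAt_const.fun_mul (hw _ _))).fun_add
      (analyticAt_const.fun_mul (hw _ _))).fun_sub (hw _ _)).fun_neg
  have hc : ∀ c : ℂ, AnalyticAt ℂ (fun _ : Fin g → ℂ => c) u := fun c => analyticAt_const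
  exact ((((((h2 _ _).fun_mul (hc _)).fun_sub ((h2 _ _).fun_mul (hc _))).fun_add
    ((h2 _ _).fun_mul (hc _))).fun_add ((hc _).fun_mul (h2 _ _))).fun_sub
    ((hc _).fun_mul (h2 _ _))).fun_add ((hc _).fun_mul (h2 _ _))

theorem analyticAt_eval_lhsPoly (hζ : ∀ j, AnalyticAt ℂ (ζ j) u) (v : Fin 4 → ℂ) :
    AnalyticAt ℂ (fun u => eval v (lhsPoly ζ u)) u := by
  simp only [lhsPoly, map_sum, map_mul, eval_C]
  exact Finset.analyticAt_fun_sum _ fun m _ => (analyticAt_sqBr hζ m).fun_mul analyticAt_const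

theorem analyticAt_eval_rhsPoly (hζ : ∀ j, AnalyticAt ℂ (ζ j) u) (v : Fin 4 → ℂ) :
    AnalyticAt ℂ (fun u => eval v (rhsPoly lam ζ u)) u := by
  simp only [rhsPoly, map_sub, map_add, map_mul, map_sum, eval_C]
  exact ((analyticAt_const.fun_mul (Finset.analyticAt_fun_sum _ fun a _ =>
    (analyticAt_ang4 hζ a).fun_mul analyticAt_const)).fun_add
    (analyticAt_const.fun_mul (Finset.analyticAt_fun_sum _ fun a _ =>
    (analyticAt_dang4 hζ a).fun_mul analyticAt_const))).fun_sub analyticAt_const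

/-- With x, y, z, t fixed, both sides are analytic in u on the connected set Ω and agree near a
point of U. -/
theorem IsZeta.lhsPoly_eq_rhsPoly {Ω : Set (Fin g → ℂ)} (hζ : IsZeta lam Ω ζ) (hu : u ∈ Ω) :
    lhsPoly ζ u = rhsPoly lam ζ u := by
  obtain ⟨U, x, y, hUΩ, hU, ⟨u₀, hu₀⟩, h, hd⟩ := hζ.differential
  refine MvPolynomial.funext fun v => ?_
  refine AnalyticOnNhd.eqOn_of_preconnected_of_eventuallyEq
    (f := fun u => eval v (lhsPoly ζ u)) (g := fun u => eval v (rhsPoly lam ζ u))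
    (fun w hw => analyticAt_eval_lhsPoly (fun j => hζ.analytic j w hw) v)
    (fun w hw => analyticAt_eval_rhsPoly (fun j => hζ.analytic j w hw) v)
    hζ.isPreconnected (hUΩ hu₀) ?_ hu
  filter_upwards [hU.mem_nhds hu₀] with w hw
  rw [HyperWp.lhsPoly_eq_rhsPoly h hU (fun j w hw => hζ.analytic j w (hUΩ hw)) hd hw]

theorem coeff_symMon (a b : Fin 4 → ℕ) :
    (symMon a).coeff (Finsupp.equivFunOnFinite.symm b) = if b ∈ orbit a then 1 else 0 := by
  have hm : ∀ c : Fin 4 → ℕ, (∏ i, X i ^ c i : MvPolynomial (Fin 4) ℂ) =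
      monomial (Finsupp.equivFunOnFinite.symm c) 1 := by
    intro c
    rw [monomial_eq, C_1, one_mul, Finsupp.prod_fintype _ _ fun i => pow_zero _]
    rfl
  rw [symMon, coeff_sum]
  simp only [hm, coeff_monomial, EmbeddingLike.apply_eq_iff_eq]
  rw [Finset.sum_ite_eq']
  rfl

/-- Two decreasing quadruples with a common rearrangement are equal, so only one summand contains
the given monomial, with coefficient 1. -/
theorem coeff_lhsPoly {m : Fin 4 → ℕ} (hm : m ∈ weakQuads g) :
    (lhsPoly ζ u).coeff (Finsupp.equivFunOnFinite.symm fun i => m i - 1) = sqBr ζ m u := by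
  have hweak : ∀ {m : Fin 4 → ℕ}, m ∈ weakQuads g → Antitone m ∧ ∀ i, 1 ≤ m i := by
    intro m hm
    rw [weakQuads, Finset.mem_filter, Fintype.mem_piFinset, ← antitone_iff_four] at hm
    exact ⟨hm.2, fun i => (Finset.mem_Icc.1 (hm.1 i)).1⟩
  rw [lhsPoly, coeff_sum, Finset.sum_eq_single m]
  · have h1 : (fun i => m i - 1) ∈ orbit (fun i => m i - 1) := mem_orbit.2 ⟨1, rfl⟩
    rw [coeff_C_mul, coeff_symMon, if_pos h1, mul_one]
  · intro m' hm' hne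
    rw [coeff_C_mul, coeff_symMon, if_neg, mul_zero]
    intro hmem
    obtain ⟨π, hπ⟩ := mem_orbit.1 hmem
    have e : m' ∘ π = m := by
      ext i
      have h1 := congrFun hπ i
      have h2 := (hweak hm).2 i
      have h3 := (hweak hm').2 (π i)
      simp only [Function.comp] at h1 ⊢
      omega
    refine hne ?_
    have h1 : Antitone (m' ∘ (1 : Equiv.Perm (Fin 4))) := (hweak hm').1
    have h2 : Antitone (m' ∘ π) := e ▸ (hweak hm).1
    rw [← e]
    exact Tuple.unique_antitone h1 h2
  · exact fun h => absurd hm h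

theorem coeff_rhsPoly (n : Fin 4 →₀ ℕ) :
    (rhsPoly lam ζ u).coeff n = ∑ a ∈ strictQuads g,
      (-2 * ang4 ζ u a * (polyH * quotDet a).coeff n
        + (1 / 2 * dang4 lam ζ u a - 1 / 8 * cur4 lam a) * (quotDet a).coeff n) := by
  have e : rhsPoly lam ζ u = ∑ a ∈ strictQuads g, (C (-2 * ang4 ζ u a) * (polyH * quotDet a)
      + C (1 / 2 * dang4 lam ζ u a - 1 / 8 * cur4 lam a) * quotDet a) := by
    rw [rhsPoly, Finset.mul_sum, Finset.mul_sum, Finset.mul_sum, ← Finset.sum_add_distrib,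
      ← Finset.sum_sub_distrib]
    refine Finset.sum_congr rfl fun a _ => ?_
    have h2 : (C (2 : ℂ) : MvPolynomial (Fin 4) ℂ) = 2 := map_ofNat C 2
    simp only [C_mul, C_sub, C_neg, h2]
    ring
  rw [e, coeff_sum]
  simp only [coeff_add, coeff_C_mul]

end

end HyperWp

theorem mainTheorem1 (g : ℕ) (lam : Fin (2 * g + 2) → ℂ) (Ω : Set (Fin g → ℂ))
    (ζ : Fin g → (Fin g → ℂ) → ℂ) (hζ : HyperWp.IsZeta lam Ω ζ) :
    (∀ u ∈ Ω,
      (∑ m ∈ HyperWp.weakQuads g,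
          MvPolynomial.C (HyperWp.sqBr ζ m u) * HyperWp.symMon (fun i => m i - 1)) =
        -2 * HyperWp.polyH *
            (∑ a ∈ HyperWp.strictQuads g,
              MvPolynomial.C (HyperWp.ang4 ζ u a) * HyperWp.quotDet a)
          + MvPolynomial.C (1 / 2) *
            (∑ a ∈ HyperWp.strictQuads g,
              MvPolynomial.C (HyperWp.dang4 lam ζ u a) * HyperWp.quotDet a)
          - MvPolynomial.C (1 / 8) *
            (∑ a ∈ HyperWp.strictQuads g,
              MvPolynomial.C (HyperWp.cur4 lam a) * HyperWp.quotDet a)) ∧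
    (∀ u ∈ Ω, ∀ m ∈ HyperWp.weakQuads g,
      HyperWp.sqBr ζ m u =
        ∑ a ∈ HyperWp.strictQuads g,
          (-2 * HyperWp.ang4 ζ u a *
              (HyperWp.polyH * HyperWp.quotDet a).coeff
                (Finsupp.equivFunOnFinite.symm fun i => m i - 1)
            + (1 / 2 * HyperWp.dang4 lam ζ u a - 1 / 8 * HyperWp.cur4 lam a) *
              (HyperWp.quotDet a).coeff (Finsupp.equivFunOnFinite.symm fun i => m i - 1))) ∧
    (HyperWp.weakQuads g).card = (g + 3).choose 4 := by
  refine ⟨fun u hu => hζ.lhsPoly_eq_rhsPoly hu, fun u hu m hm => ?_, HyperWp.card_weakQuads g⟩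
  rw [← HyperWp.coeff_rhsPoly, ← hζ.lhsPoly_eq_rhsPoly hu, HyperWp.coeff_lhsPoly hm]
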